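/- A formula of the first-order theory of the reals is built from variables and the constants $0$ and $1$ by means of the binary operation symbols $+,-,\times$, the relation symbols $\le,<,\ge,>,=,\ne$, the logical connectives $\wedge,\vee,\neg,\Leftrightarrow$, and the quantifiers $\forall,\exists$; all variables range over $\mathbb R$, and all symbols have their usual meaning there. Theorem (Tarski). There is an algorithm (a computable function on formulas) that accepts as input an arbitrary formula $\Psi$ of the first-order theory of the reals, possibly containing quantifiers, with free variables $Y_1,\ldots,Y_n$ ($n\ge 0$), and outputs a quantifier-free formula $\Phi$ of the first-order theory of the reals, all of whose variables are among $Y_1,\ldots,Y_n$, that is equivalent to $\Psi$: for every $(y_1,\ldots,y_n)\in\mathbb R^n$, the formula $\Psi(y_1,\ldots,y_n)$ is true if and only if $\Phi(y_1,\ldots,y_n)$ is true. -/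

import Mathlib

/-! First-order theory of the reals: syntax, semantics, and Gödel numbers of formulas.
Variables are named by natural numbers. -/

namespace RealFO

/-- Terms: built from variables and the constants `0`, `1` with the binary operation symbols
`+`, `-`, `×`. -/
inductive Term : Type
  | var (i : ℕ)
  | zero
  | one
  | add (s t : Term)
  | sub (s t : Term)
  | mul (s t : Term)

/-- The relation symbols `≤`, `<`, `≥`, `>`, `=`, `≠`. -/
inductive Rel : Type
  | le
  | lt
  | ge
  | gt
  | eq
  | ne

/-- Formulas of the first-order theory of the reals. -/
inductive Formula : Type
  | rel (r : Rel) (s t : Term)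
  | and (A B : Formula)
  | or (A B : Formula)
  | not (A : Formula)
  | iff (A B : Formula)
  | all (i : ℕ) (A : Formula)
  | ex (i : ℕ) (A : Formula)

/-- The value of a term in `ℝ` under an assignment of real numbers to the variables. -/
noncomputable def Term.eval (v : ℕ → ℝ) : Term → ℝ
  | .var i => v i
  | .zero => 0
  | .one => 1
  | .add s t => s.eval v + t.eval v
  | .sub s t => s.eval v - t.eval v
  | .mul s t => s.eval v * t.eval v

/-- The relation on `ℝ` denoted by a relation symbol. -/
def Rel.Holds : Rel → ℝ → ℝ → Prop
  | .le, x, y => x ≤ y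
  | .lt, x, y => x < y
  | .ge, x, y => x ≥ y
  | .gt, x, y => x > y
  | .eq, x, y => x = y
  | .ne, x, y => x ≠ y

/-- Truth of a formula in `ℝ` under an assignment; quantifiers range over all real numbers. -/
def Formula.Holds : Formula → (ℕ → ℝ) → Prop
  | .rel r s t, v => r.Holds (s.eval v) (t.eval v)
  | .and A B, v => A.Holds v ∧ B.Holds v
  | .or A B, v => A.Holds v ∨ B.Holds v
  | .not A, v => ¬ A.Holds v
  | .iff A B, v => (A.Holds v ↔ B.Holds v)
  | .all i A, v => ∀ x : ℝ, A.Holds (Function.update v i x)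
  | .ex i A, v => ∃ x : ℝ, A.Holds (Function.update v i x)

/-- The variables occurring in a term. -/
def Term.vars : Term → Finset ℕ
  | .var i => {i}
  | .zero => ∅
  | .one => ∅
  | .add s t => s.vars ∪ t.vars
  | .sub s t => s.vars ∪ t.vars
  | .mul s t => s.vars ∪ t.vars

/-- The variables that occur free in a formula. -/
def Formula.freeVars : Formula → Finset ℕ
  | .rel _ s t => s.vars ∪ t.vars
  | .and A B => A.freeVars ∪ B.freeVars
  | .or A B => A.freeVars ∪ B.freeVars
  | .not A => A.freeVars
  | .iff A B => A.freeVars ∪ B.freeVars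
  | .all i A => A.freeVars.erase i
  | .ex i A => A.freeVars.erase i

/-- A formula is quantifier-free if neither `∀` nor `∃` occurs in it. -/
def Formula.QuantifierFree : Formula → Prop
  | .rel _ _ _ => True
  | .and A B => A.QuantifierFree ∧ B.QuantifierFree
  | .or A B => A.QuantifierFree ∧ B.QuantifierFree
  | .not A => A.QuantifierFree
  | .iff A B => A.QuantifierFree ∧ B.QuantifierFree
  | .all _ _ => False
  | .ex _ _ => False

/-- The Gödel number of a term: a tag for the outermost symbol, paired with the numbers of
the constituents. -/
def Term.code : Term → ℕ
  | .var i => Nat.pair 0 i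
  | .zero => Nat.pair 1 0
  | .one => Nat.pair 2 0
  | .add s t => Nat.pair 3 (Nat.pair s.code t.code)
  | .sub s t => Nat.pair 4 (Nat.pair s.code t.code)
  | .mul s t => Nat.pair 5 (Nat.pair s.code t.code)

/-- The number of a relation symbol. -/
def Rel.code : Rel → ℕ
  | .le => 0
  | .lt => 1
  | .ge => 2
  | .gt => 3
  | .eq => 4
  | .ne => 5

/-- The Gödel number of a formula. -/
def Formula.code : Formula → ℕ
  | .rel r s t => Nat.pair 0 (Nat.pair r.code (Nat.pair s.code t.code))
  | .and A B => Nat.pair 1 (Nat.pair A.code B.code)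
  | .or A B => Nat.pair 2 (Nat.pair A.code B.code)
  | .not A => Nat.pair 3 A.code
  | .iff A B => Nat.pair 4 (Nat.pair A.code B.code)
  | .all i A => Nat.pair 5 (Nat.pair i A.code)
  | .ex i A => Nat.pair 6 (Nat.pair i A.code)

theorem Term.code_injective : Function.Injective Term.code := by
  intro s
  induction s <;> intro t h <;> cases t <;> simp_all [Term.code, Nat.pair_eq_pair]
  all_goals grind

theorem Rel.code_injective : Function.Injective Rel.code := by
  intro r s h
  cases r <;> cases s <;> simp_all [Rel.code]

/-- Distinct formulas have distinct Gödel numbers. -/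
theorem Formula.code_injective : Function.Injective Formula.code := by
  intro A
  induction A <;> intro B h <;> cases B <;> simp_all [Formula.code, Nat.pair_eq_pair]
  case rel.rel => exact ⟨Rel.code_injective h.1, Term.code_injective h.2.1,
    Term.code_injective h.2.2⟩
  all_goals grind

end RealFO

/-! It suffices to remove one `∃ x` in front of a conjunction of conditions `t = 0` and `0 < t`:
disjunctive normal forms are closed under the connectives, and `∀` is `¬ ∃ ¬`. The equations merge
into a single `P = 0`, where `P` is the sum of their squares; let `q₁, …, qₙ` be the terms required
to be positive.

If `P` is a nonzero polynomial in `x`, it has finitely many roots, and the sum over them of `∏ (sign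
qⱼ + (sign qⱼ)²)` is `2ⁿ` times the number of roots at which all `qⱼ` are positive. Expanding the
product gives sums of `sign r(x)` over the roots of `P`, each of which is the Cauchy index of `P' r
/ P` (`cauchyIndex_derivative_mul`). If `P` vanishes identically, `exists_common_pos_critical`
supplies a nonzero polynomial that can take its place.

Cauchy indices are computed by Euclid's algorithm. The index of `q / p` depends only on `q` modulo
`p`, up to positive factors (`cauchyIndex_mul_add`), and numerator and denominator are exchanged by
the inversion formula `cauchyIndex_add_cauchyIndex`, which comes from counting sign changes of `p q`
(`sum_crossing`). The coefficients are terms in the other variables, so the algorithm branches on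
the signs of leading coefficients and records them as assumptions. The disjunction, over the
branches with positive outcome, of their assumptions is the desired condition
(`dnfHolds_indexSumPos`, `dnfHolds_elimConj`).

All of this manipulates finite lists of terms. It is primitive recursive in Gödel numbers because
structural recursion on syntax becomes course-of-values recursion along `Nat.unpair`
(`Primrec.of_unpair_rec`). -/

namespace Polynomial

/-! ### Local behaviour of real polynomials and their sign changes. -/

/-- The lowest non-vanishing Taylor coefficient of `p` at `x`. -/
noncomputable def lowestCoeffAt (p : ℝ[X]) (x : ℝ) : ℝ :=
  (p /ₘ (X - C x) ^ p.rootMultiplicity x).eval x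

theorem eq_pow_mul_lowestCoeffAt {p : ℝ[X]} (hp : p ≠ 0) (x : ℝ) :
    ∃ r : ℝ[X], p = (X - C x) ^ p.rootMultiplicity x * r ∧ r.eval x ≠ 0 ∧
      lowestCoeffAt p x = r.eval x :=
  ⟨_, (pow_mul_divByMonic_rootMultiplicity_eq p x).symm,
    eval_divByMonic_pow_rootMultiplicity_ne_zero x hp, rfl⟩

theorem lowestCoeffAt_eq_of_eq_pow_mul {p r : ℝ[X]} {x : ℝ} {n : ℕ}
    (h : p = (X - C x) ^ n * r) (hr : r.eval x ≠ 0) :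
    p.rootMultiplicity x = n ∧ lowestCoeffAt p x = r.eval x := by
  have hr0 : r ≠ 0 := by rintro rfl; simp at hr
  have hn : p.rootMultiplicity x = n := by
    rw [h, mul_comm, rootMultiplicity_mul_X_sub_C_pow hr0,
      rootMultiplicity_eq_zero (by simpa [IsRoot] using hr), zero_add]
  refine ⟨hn, ?_⟩
  rw [lowestCoeffAt, hn, h, mul_divByMonic_cancel_left _ ((monic_X_sub_C x).pow n)]

@[simp] theorem lowestCoeffAt_zero (x : ℝ) : lowestCoeffAt 0 x = 0 := by simp [lowestCoeffAt]

theorem lowestCoeffAt_of_eval_ne_zero {p : ℝ[X]} {x : ℝ} (h : p.eval x ≠ 0) :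
    lowestCoeffAt p x = p.eval x :=
  (lowestCoeffAt_eq_of_eq_pow_mul (n := 0) (by simp) h).2

theorem lowestCoeffAt_mul (p q : ℝ[X]) (x : ℝ) :
    lowestCoeffAt (p * q) x = lowestCoeffAt p x * lowestCoeffAt q x := by
  rcases eq_or_ne p 0 with rfl | hp
  · simp
  rcases eq_or_ne q 0 with rfl | hq
  · simp
  obtain ⟨r, hr, hr0, hrl⟩ := eq_pow_mul_lowestCoeffAt hp x
  obtain ⟨s, hs, hs0, hsl⟩ := eq_pow_mul_lowestCoeffAt hq x
  rw [hrl, hsl, ← eval_mul]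
  refine (lowestCoeffAt_eq_of_eq_pow_mul
    (n := p.rootMultiplicity x + q.rootMultiplicity x) ?_ (by simp [hr0, hs0])).2
  conv_lhs => rw [hr, hs]
  ring

/-- The local Cauchy index of the rational function `q / p` at `x`. -/
noncomputable def jump (p q : ℝ[X]) (x : ℝ) : ℤ :=
  if q.rootMultiplicity x < p.rootMultiplicity x ∧
      Odd (p.rootMultiplicity x + q.rootMultiplicity x) then
    (SignType.sign (lowestCoeffAt p x * lowestCoeffAt q x) : ℤ) else 0

/-- Half the change of sign of `f` at `x`. -/
noncomputable def crossing (f : ℝ[X]) (x : ℝ) : ℤ :=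
  if Odd (f.rootMultiplicity x) then (SignType.sign (lowestCoeffAt f x) : ℤ) else 0

/-- Only the quotient whose denominator has the larger multiplicity at `x` can jump, and the parity
condition is that of the multiplicity of `p * q`. Equal multiplicities have even sum, so both sides
vanish. -/
theorem jump_add_jump {p q : ℝ[X]} (hp : p ≠ 0) (hq : q ≠ 0) (x : ℝ) :
    jump p q x + jump q p x = crossing (p * q) x := by
  unfold jump crossing
  rw [rootMultiplicity_mul (mul_ne_zero hp hq), lowestCoeffAt_mul,
    add_comm (q.rootMultiplicity x) (p.rootMultiplicity x),
    mul_comm (lowestCoeffAt q x) (lowestCoeffAt p x)]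
  rcases lt_trichotomy (p.rootMultiplicity x) (q.rootMultiplicity x) with h | h | h
  · simp [h, h.le]
  · simp [h]
  · simp [h, h.le]

/-- Once the power of `X - C b` is divided out, all roots lie strictly left of `b`, so the cofactor
keeps the sign of its leading coefficient on `[b, ∞)`. -/
theorem sign_lowestCoeffAt_of_forall_roots_le {g : ℝ[X]} (hg : g ≠ 0) {b : ℝ}
    (h : ∀ y, g.IsRoot y → y ≤ b) :
    SignType.sign (lowestCoeffAt g b) = SignType.sign g.leadingCoeff := by
  obtain ⟨r, hr, hr0, hrl⟩ := eq_pow_mul_lowestCoeffAt hg b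
  have hroots : ∀ y, r.IsRoot y → y < b := by
    intro y hy
    refine lt_of_le_of_ne (h y ?_) ?_
    · rw [hr]; simp only [IsRoot, eval_mul] at *; simp [hy]
    · rintro rfl; exact hr0 hy
  have hlc : g.leadingCoeff = r.leadingCoeff := by
    conv_lhs => rw [hr]
    rw [leadingCoeff_mul, ((monic_X_sub_C b).pow _).leadingCoeff, one_mul]
  rw [hrl, hlc]
  have hr' : r.leadingCoeff ≠ 0 := by
    rw [← hlc]; exact leadingCoeff_ne_zero.2 hg
  rcases lt_or_gt_of_ne hr' with hl | hl
  · rw [sign_neg hl, sign_neg (eval_lt_zero_of_roots_lt_of_leadingCoeff_nonpos hroots hl.le)]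
  · rw [sign_pos hl, sign_pos (zero_lt_eval_of_roots_lt_of_leadingCoeff_nonneg hroots hl.le)]

/-- With a nonnegative leading coefficient, the absence of roots to the right of `0` gives `f(0) >
0`, and the absence of roots to the left gives `(-1) ^ deg f * f(0) > 0`. -/
theorem even_natDegree_of_forall_not_isRoot {f : ℝ[X]} (h : ∀ y, ¬ f.IsRoot y) :
    Even f.natDegree := by
  wlog hl : 0 ≤ f.leadingCoeff generalizing f
  · have := this (f := -f) (by simpa [IsRoot] using h)
      (by rw [leadingCoeff_neg]; linarith)
    simpa using this
  have h1 := zero_lt_eval_of_roots_lt_of_leadingCoeff_nonneg (P := f) (x := 0)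
    (fun y hy => (h y hy).elim) hl
  have h2 := zero_lt_negOnePow_mul_eval_of_lt_roots_of_leadingCoeff_nonneg (P := f) (x := 0)
    (fun y hy => (h y hy).elim) hl
  by_contra hodd
  rw [Int.negOnePow_odd _ (by simpa using hodd)] at h2
  push_cast at h2
  linarith

/-- Both sides are half the difference of the signs at `+∞` and `-∞`. The induction on the degree
splits off the largest root `b`, writing `f = (X - b) g`; allowing any `S` that contains the roots
lets `f` and `g` share one index set. -/
theorem sum_crossing {f : ℝ[X]} (hf : f ≠ 0) (S : Finset ℝ) (hS : f.roots.toFinset ⊆ S) :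
    ∑ x ∈ S, crossing f x =
      if Odd f.natDegree then (SignType.sign f.leadingCoeff : ℤ) else 0 := by
  have key : ∀ n (f : ℝ[X]), f ≠ 0 → f.natDegree = n → ∀ S : Finset ℝ, f.roots.toFinset ⊆ S →
      ∑ x ∈ S, crossing f x =
        if Odd f.natDegree then (SignType.sign f.leadingCoeff : ℤ) else 0 := by
    intro n
    induction n with
    | zero =>
      intro f hf hd S _
      rw [hd, if_neg (by simp)]
      refine Finset.sum_eq_zero fun x _ => ?_
      rw [eq_C_of_natDegree_eq_zero hd, crossing, rootMultiplicity_C]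
      simp
    | succ n ih =>
      intro f hf hd S hS
      have hmem : ∀ {y}, f.IsRoot y → y ∈ f.roots.toFinset := fun hy => by
        simpa [hf] using hy
      rcases f.roots.toFinset.eq_empty_or_nonempty with he | hne
      · have hno : ∀ y, ¬ f.IsRoot y := fun y hy => by simpa [he] using hmem hy
        rw [if_neg (by simpa using even_natDegree_of_forall_not_isRoot hno)]
        refine Finset.sum_eq_zero fun x _ => ?_
        rw [crossing, rootMultiplicity_eq_zero (hno x)]
        simp
      · set b := f.roots.toFinset.max' hne with hb
        have hbr : f.IsRoot b := by
          have := f.roots.toFinset.max'_mem hne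
          rw [Multiset.mem_toFinset, mem_roots hf] at this
          exact this
        obtain ⟨g, hg⟩ := dvd_iff_isRoot.2 hbr
        have hg0 : g ≠ 0 := by rintro rfl; simp at hg; exact hf hg
        have hle : ∀ y, g.IsRoot y → y ≤ b := by
          intro y hy
          refine Finset.le_max' _ _ (hmem ?_)
          rw [hg]; simp only [IsRoot, eval_mul] at *; simp [hy]
        have hgd : g.natDegree = n := by
          rw [hg, natDegree_mul (X_sub_C_ne_zero b) hg0, natDegree_X_sub_C] at hd
          omega
        have hlc : f.leadingCoeff = g.leadingCoeff := by
          rw [hg, leadingCoeff_mul, leadingCoeff_X_sub_C, one_mul]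
        have hgS : g.roots.toFinset ⊆ S := by
          refine Finset.Subset.trans ?_ hS
          intro y hy
          refine hmem ?_
          rw [Multiset.mem_toFinset, mem_roots hg0] at hy
          rw [hg]; simp only [IsRoot, eval_mul] at *; simp [hy]
        have hbS : b ∈ S := hS (hmem hbr)
        have hsum := ih g hg0 hgd S hgS
        -- Roots of `g` other than `b` lie left of `b`, where the factor `X - b` is negative; at all
        -- other points both crossings are zero.
        have hoff : ∀ x ∈ S.erase b, crossing f x = - crossing g x := by
          intro x hx
          have hxb : x ≠ b := Finset.ne_of_mem_erase hx
          have hev : (X - C b).eval x = x - b := by simp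
          have hev0 : (X - C b).eval x ≠ 0 := by rw [hev]; exact sub_ne_zero.2 hxb
          unfold crossing
          have hmul : f.rootMultiplicity x = g.rootMultiplicity x := by
            rw [hg, rootMultiplicity_mul (hg ▸ hf),
              rootMultiplicity_eq_zero (by simpa [IsRoot, sub_eq_zero] using hxb), zero_add]
          rw [hmul]
          split_ifs with hodd
          · have hxg : x ≤ b := hle x (by
              have : 0 < g.rootMultiplicity x := hodd.pos
              exact (rootMultiplicity_pos hg0).1 this)
            have hxg' : x - b < 0 := sub_neg.2 (lt_of_le_of_ne hxg hxb)
            rw [hg, lowestCoeffAt_mul, lowestCoeffAt_of_eval_ne_zero hev0, hev, sign_mul,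
              sign_neg hxg']
            simp
          · simp
        -- The multiplicities of `f` and `g` at `b` differ by one, so exactly one is odd, and that
        -- one contributes the sign.
        have hat : crossing f b + crossing g b = (SignType.sign g.leadingCoeff : ℤ) := by
          have hmul : f.rootMultiplicity b = g.rootMultiplicity b + 1 := by
            rw [hg, rootMultiplicity_mul (hg ▸ hf), rootMultiplicity_X_sub_C_self, add_comm]
          have hlow : lowestCoeffAt f b = lowestCoeffAt g b := by
            rw [hg, lowestCoeffAt_mul,
              (lowestCoeffAt_eq_of_eq_pow_mul (p := X - C b) (r := 1) (x := b) (n := 1)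
                (by simp) (by simp)).2]
            simp
          unfold crossing
          rw [hmul, hlow, sign_lowestCoeffAt_of_forall_roots_le hg0 hle]
          by_cases hodd : Odd (g.rootMultiplicity b)
          · rw [if_neg (by simpa [Nat.even_add_one] using hodd), if_pos hodd, zero_add]
          · rw [if_pos (by simpa [Nat.odd_add_one] using hodd), if_neg hodd, add_zero]
        rw [← Finset.add_sum_erase S _ hbS] at hsum ⊢
        rw [Finset.sum_congr rfl hoff, Finset.sum_neg_distrib, hd, hlc]
        rw [hgd] at hsum
        by_cases hodd : Odd n
        · rw [if_pos hodd] at hsum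
          rw [if_neg (by simpa [Nat.even_add_one] using hodd)]
          linarith
        · rw [if_neg hodd] at hsum
          rw [if_pos (by simpa [Nat.odd_add_one] using hodd)]
          linarith
  exact key _ f hf rfl S hS

/-! ### Cauchy indices on the real line. -/

/-- The Cauchy index of the rational function `q / p` on the real line. -/
noncomputable def cauchyIndex (p q : ℝ[X]) : ℤ := ∑ x ∈ p.roots.toFinset, jump p q x

theorem cauchyIndex_eq_sum {p : ℝ[X]} (q : ℝ[X]) {S : Finset ℝ} (hp : p ≠ 0)
    (hS : p.roots.toFinset ⊆ S) : cauchyIndex p q = ∑ x ∈ S, jump p q x := by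
  refine Finset.sum_subset hS fun x _ hx => ?_
  have : ¬ p.IsRoot x := by simpa [hp] using hx
  rw [jump, rootMultiplicity_eq_zero this]
  simp

-- `roots` of the zero polynomial is empty by convention. This is why a positive index sum later
-- certifies that the denominator is nonzero.
@[simp] theorem cauchyIndex_zero_left (q : ℝ[X]) : cauchyIndex 0 q = 0 := by simp [cauchyIndex]

@[simp] theorem cauchyIndex_zero_right (p : ℝ[X]) : cauchyIndex p 0 = 0 := by
  simp [cauchyIndex, jump]

/-- The inversion formula for Cauchy indices. -/
theorem cauchyIndex_add_cauchyIndex {p q : ℝ[X]} (hp : p ≠ 0) (hq : q ≠ 0) :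
    cauchyIndex p q + cauchyIndex q p =
      if Odd (p.natDegree + q.natDegree) then
        (SignType.sign (p.leadingCoeff * q.leadingCoeff) : ℤ) else 0 := by
  have hpq := mul_ne_zero hp hq
  rw [cauchyIndex_eq_sum q hp (S := (p * q).roots.toFinset),
    cauchyIndex_eq_sum p hq (S := (p * q).roots.toFinset), ← Finset.sum_add_distrib,
    Finset.sum_congr rfl fun x _ => jump_add_jump hp hq x, sum_crossing hpq _ subset_rfl,
    natDegree_mul hp hq, leadingCoeff_mul]
  · intro x; simp [hpq, hq]; tauto
  · intro x; simp [hpq, hp]; tauto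

theorem lowestCoeffAt_neg (q : ℝ[X]) (x : ℝ) : lowestCoeffAt (-q) x = - lowestCoeffAt q x := by
  have : -q = C (-1) * q := by simp
  rw [this, lowestCoeffAt_mul, lowestCoeffAt_of_eval_ne_zero (by simp)]
  simp

theorem cauchyIndex_neg_right (p q : ℝ[X]) : cauchyIndex p (-q) = - cauchyIndex p q := by
  unfold cauchyIndex
  rw [← Finset.sum_neg_distrib]
  refine Finset.sum_congr rfl fun x _ => ?_
  have hr : (-q).rootMultiplicity x = q.rootMultiplicity x := by
    rcases eq_or_ne q 0 with rfl | hq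
    · simp
    · have : -q = C (-1) * q := by simp
      rw [this, rootMultiplicity_mul (by simpa using hq), rootMultiplicity_C, zero_add]
  rw [jump, jump, hr, lowestCoeffAt_neg, mul_neg, Left.sign_neg]
  split_ifs <;> simp

/-- Adding `p * h` to the numerator adds a polynomial to the quotient, which leaves its poles alone;
a positive factor preserves signs. -/
theorem cauchyIndex_mul_add (p q h : ℝ[X]) {c : ℝ} (hc : 0 < c) :
    cauchyIndex p (C c * q + p * h) = cauchyIndex p q := by
  rcases eq_or_ne p 0 with rfl | hp
  · simp
  refine Finset.sum_congr rfl fun x _ => ?_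
  -- If `q` vanishes to lower order than `p`, its lowest coefficient at `x` is merely scaled by `c`.
  -- Otherwise both numerators are divisible by the full power of `X - C x` in `p`, and neither
  -- quotient jumps.
  by_cases hlt : q ≠ 0 ∧ q.rootMultiplicity x < p.rootMultiplicity x
  · obtain ⟨hq, hlt⟩ := hlt
    obtain ⟨r, hr, hr0, hrl⟩ := eq_pow_mul_lowestCoeffAt hp x
    obtain ⟨s, hs, hs0, hsl⟩ := eq_pow_mul_lowestCoeffAt hq x
    obtain ⟨k, hk⟩ := Nat.exists_eq_add_of_lt hlt
    have hev : (C c * s + (X - C x) ^ (k + 1) * r * h).eval x = c * s.eval x := by simp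
    obtain ⟨h1, h2⟩ := lowestCoeffAt_eq_of_eq_pow_mul (p := C c * q + p * h) (x := x)
      (r := C c * s + (X - C x) ^ (k + 1) * r * h) (n := q.rootMultiplicity x) (by
        conv_lhs => rw [hr, hs]
        rw [hk]; ring) (by rw [hev]; exact mul_ne_zero hc.ne' hs0)
    rw [jump, jump, h1, h2, hev, hsl, mul_left_comm, sign_mul, sign_pos hc, one_mul]
  · have hdvd : (X - C x) ^ p.rootMultiplicity x ∣ q := by
      rcases eq_or_ne q 0 with rfl | hq
      · exact dvd_zero _
      · exact (le_rootMultiplicity_iff hq).1 (not_lt.1 fun h => hlt ⟨hq, h⟩)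
    have hz : ∀ g : ℝ[X], (X - C x) ^ p.rootMultiplicity x ∣ g → jump p g x = 0 := by
      intro g hg
      rcases eq_or_ne g 0 with rfl | hg0
      · simp [jump]
      · rw [jump, if_neg]
        exact fun h => not_le.2 h.1 ((le_rootMultiplicity_iff hg0).2 hg)
    rw [hz _ hdvd, hz]
    exact dvd_add (hdvd.mul_left _) ((pow_rootMultiplicity_dvd p x).mul_right _)

/-- At a root of multiplicity `m + 1`, with `p = (X - x)^(m+1) s`, the logarithmic derivative has a
simple pole: the relevant product of lowest coefficients is `(m + 1) s(x)² r(x)`, with the sign of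
`r(x)`. If `r(x) = 0` the pole cancels, in agreement with `sign 0 = 0`. -/
theorem cauchyIndex_derivative_mul (p r : ℝ[X]) :
    cauchyIndex p (derivative p * r) =
      ∑ x ∈ p.roots.toFinset, (SignType.sign (r.eval x) : ℤ) := by
  refine Finset.sum_congr rfl fun x hx => ?_
  have hp : p ≠ 0 := by rintro rfl; simp at hx
  have hroot : p.IsRoot x := by simpa [hp] using hx
  obtain ⟨s, hs, hs0, hsl⟩ := eq_pow_mul_lowestCoeffAt hp x
  obtain ⟨m, hm⟩ : ∃ m, p.rootMultiplicity x = m + 1 :=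
    ⟨_, (Nat.succ_pred_eq_of_pos ((rootMultiplicity_pos hp).2 hroot)).symm⟩
  rw [hm] at hs
  have hder : derivative p =
      (X - C x) ^ m * (C (m + 1 : ℝ) * s + (X - C x) * derivative s) := by
    conv_lhs => rw [hs]
    simp [derivative_mul, derivative_pow]
    ring
  by_cases hr : r.eval x = 0
  · have hdvd : (X - C x) ^ (m + 1) ∣ derivative p * r := by
      rw [hder, pow_succ]
      exact mul_dvd_mul (Dvd.intro _ rfl) (dvd_iff_isRoot.2 hr)
    rw [hr]
    simp only [sign_zero, SignType.coe_zero]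
    rcases eq_or_ne (derivative p * r) 0 with h0 | h0
    · simp [jump, h0]
    · rw [jump, if_neg]
      intro h
      have := (le_rootMultiplicity_iff h0).2 hdvd
      omega
  · have hm0 : (0 : ℝ) < m + 1 := by positivity
    have hev : ((C (m + 1 : ℝ) * s + (X - C x) * derivative s) * r).eval x =
        (m + 1) * s.eval x * r.eval x := by simp
    obtain ⟨h1, h2⟩ := lowestCoeffAt_eq_of_eq_pow_mul (p := derivative p * r) (x := x) (n := m)
      (r := (C (m + 1 : ℝ) * s + (X - C x) * derivative s) * r) (by rw [hder]; ring)
      (by rw [hev]; exact mul_ne_zero (mul_ne_zero hm0.ne' hs0) hr)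
    rw [jump, h1, h2, hev, hm, hsl, if_pos ⟨by omega, ⟨m, by ring⟩⟩,
      show s.eval x * ((m + 1) * s.eval x * r.eval x) =
        ((m + 1) * (s.eval x * s.eval x)) * r.eval x by ring, sign_mul,
      sign_pos (mul_pos hm0 (mul_self_pos.2 hs0)), one_mul]

/-! ### Moving a common point of positivity to a critical point. -/

/-- If finitely many polynomials are positive at a common point, then they are positive at a
common root of the numerator of the derivative of `Q / (1 + (x Q) ^ 2)`, where `Q` is their
product. -/
theorem exists_common_pos_critical (qs : List ℝ[X]) {x₀ : ℝ} (h₀ : ∀ q ∈ qs, 0 < q.eval x₀) :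
    derivative qs.prod * (1 + (X * qs.prod) * (X * qs.prod)) -
        qs.prod * derivative (1 + (X * qs.prod) * (X * qs.prod)) ≠ 0 ∧
      ∃ x, (derivative qs.prod * (1 + (X * qs.prod) * (X * qs.prod)) -
        qs.prod * derivative (1 + (X * qs.prod) * (X * qs.prod))).eval x = 0 ∧
        ∀ q ∈ qs, 0 < q.eval x := by
  set Q := qs.prod with hQ
  set H : ℝ[X] := 1 + (X * Q) * (X * Q) with hH
  have hQe : ∀ x, Q.eval x = (qs.map (eval x)).prod := fun x => by
    rw [hQ, ← coe_evalRingHom, map_list_prod]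
  have hHe : ∀ x, H.eval x = 1 + (x * Q.eval x) * (x * Q.eval x) := fun x => by simp [hH]
  have hHpos : ∀ x, 0 < H.eval x := fun x => by
    rw [hHe]; nlinarith [mul_self_nonneg (x * Q.eval x)]
  have hQ₀ : 0 < Q.eval x₀ := by
    rw [hQe]
    refine List.prod_pos fun a ha => ?_
    obtain ⟨q, hq, rfl⟩ := List.mem_map.1 ha
    exact h₀ q hq
  set f : ℝ → ℝ := fun x => Q.eval x / H.eval x with hf
  have hder : ∀ x, HasDerivAt f
      (((derivative Q * H - Q * derivative H).eval x) / (H.eval x) ^ 2) x := fun x => by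
    have := (Q.hasDerivAt x).div (H.hasDerivAt x) (hHpos x).ne'
    rw [eval_sub, eval_mul, eval_mul]
    exact this
  have hfpos : 0 < f x₀ := div_pos hQ₀ (hHpos x₀)
  -- Since `2 |x| Q ≤ 1 + (x Q)²`, one has `f x ≤ 1 / (2 |x|)`. The factor `x` in the denominator
  -- forces this decay even for constant `Q`.
  have hsmall : ∀ x, 1 / f x₀ ≤ |x| → f x ≤ f x₀ / 2 := by
    intro x hx
    rw [div_le_iff₀ hfpos] at hx
    change Q.eval x / H.eval x ≤ _
    rw [div_le_iff₀ (hHpos x)]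
    rcases le_or_gt (Q.eval x) 0 with hn | hp
    · exact hn.trans (by have := hHpos x; positivity)
    · have h1 : 2 * (|x| * Q.eval x) ≤ H.eval x := by
        rw [hHe]
        have : (|x| * Q.eval x) ^ 2 = x * Q.eval x * (x * Q.eval x) := by
          rw [mul_pow, sq_abs]; ring
        nlinarith [sq_nonneg (|x| * Q.eval x - 1)]
      have h2 : Q.eval x ≤ |x| * f x₀ * Q.eval x := by nlinarith
      nlinarith
  refine ⟨fun hR => ?_, ?_⟩
  -- A vanishing numerator would make `f` constant, against the decay.
  · have hconst : ∀ x y, f x = f y := is_const_of_deriv_eq_zero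
      (fun x => (hder x).differentiableAt) fun x => by rw [(hder x).deriv, hR]; simp
    have := hsmall (1 / f x₀) (le_abs_self _)
    rw [hconst _ x₀] at this
    linarith
  · have hcont : Continuous f :=
      continuous_iff_continuousAt.2 fun x => (hder x).continuousAt
    -- By the decay `f` attains a maximum on the closed set `K`. It is positive there, so `Q` and
    -- hence no `q` vanishes at that point, which is therefore interior to `K` and a local maximum
    -- of `f`.
    set K : Set ℝ := {x | ∀ q ∈ qs, 0 ≤ q.eval x} with hK
    have hKc : IsClosed K := by
      simp only [hK, Set.ofPred_forall]
      exact isClosed_iInter fun q => isClosed_iInter fun _ =>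
        isClosed_le continuous_const q.continuous
    obtain ⟨x, hxK, hmax⟩ := hcont.continuousOn.exists_isMaxOn' hKc
      (show x₀ ∈ K from fun q hq => (h₀ q hq).le) (by
        refine Filter.Eventually.filter_mono inf_le_left ?_
        filter_upwards [(tendsto_norm_cocompact_atTop (E := ℝ)).eventually_ge_atTop (1 / f x₀)]
          with x hx
        exact (hsmall x hx).trans (by linarith))
    have hfx : 0 < f x := hfpos.trans_le (hmax (show x₀ ∈ K from fun q hq => (h₀ q hq).le))
    have hQx : Q.eval x ≠ 0 := fun h => by simp [hf, h] at hfx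
    have hpos : ∀ q ∈ qs, 0 < q.eval x := fun q hq => by
      refine lt_of_le_of_ne (hxK q hq) fun h => hQx ?_
      rw [hQe]
      exact List.prod_eq_zero (List.mem_map.2 ⟨q, hq, h.symm⟩)
    have hnhds : ∀ᶠ y in nhds x, y ∈ K := by
      have : ∀ l : List ℝ[X], (∀ q ∈ l, 0 < q.eval x) →
          ∀ᶠ y in nhds x, ∀ q ∈ l, 0 ≤ q.eval y := by
        intro l
        induction l with
        | nil => simp
        | cons q l ih =>
          intro hl
          filter_upwards [ih fun q hq => hl q (List.mem_cons_of_mem _ hq),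
            q.continuous.continuousAt.eventually (lt_mem_nhds (hl q (List.mem_cons_self)))]
            with y hy hy'
          intro r hr
          rcases List.mem_cons.1 hr with rfl | hr
          · exact hy'.le
          · exact hy r hr
      exact this qs hpos
    have hloc : IsLocalMax f x := hnhds.mono fun y hy => hmax hy
    have h0 := hloc.hasDerivAt_eq_zero (hder x)
    refine ⟨x, ?_, hpos⟩
    rcases div_eq_zero_iff.1 h0 with h | h
    · exact h
    · exact absurd h (pow_ne_zero 2 (hHpos x).ne')

end Polynomial

/-! ### Disjunctive normal forms with literals `t = 0` and `0 < t`. -/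

namespace RealFO

open Polynomial

/-- Truth of a literal: `(true, t)` stands for `t = 0` and `(false, t)` for `0 < t`. -/
def LitHolds (v : ℕ → ℝ) (l : Bool × Term) : Prop :=
  if l.1 then l.2.eval v = 0 else 0 < l.2.eval v

def ConjHolds (v : ℕ → ℝ) (c : List (Bool × Term)) : Prop := ∀ l ∈ c, LitHolds v l

def DNFHolds (v : ℕ → ℝ) (D : List (List (Bool × Term))) : Prop := ∃ c ∈ D, ConjHolds v c

theorem conjHolds_append {v : ℕ → ℝ} {c d : List (Bool × Term)} :
    ConjHolds v (c ++ d) ↔ ConjHolds v c ∧ ConjHolds v d := by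
  simp [ConjHolds, or_imp, forall_and]

theorem conjHolds_cons {v : ℕ → ℝ} {l : Bool × Term} {c : List (Bool × Term)} :
    ConjHolds v (l :: c) ↔ LitHolds v l ∧ ConjHolds v c := by
  simp [ConjHolds]

@[simp] theorem conjHolds_nil {v : ℕ → ℝ} : ConjHolds v [] := by simp [ConjHolds]

@[simp] theorem dnfHolds_nil {v : ℕ → ℝ} : ¬ DNFHolds v [] := by simp [DNFHolds]

theorem dnfHolds_cons {v : ℕ → ℝ} {c : List (Bool × Term)} {D : List (List (Bool × Term))} :
    DNFHolds v (c :: D) ↔ ConjHolds v c ∨ DNFHolds v D := by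
  simp [DNFHolds]

theorem dnfHolds_append {v : ℕ → ℝ} {D E : List (List (Bool × Term))} :
    DNFHolds v (D ++ E) ↔ DNFHolds v D ∨ DNFHolds v E := by
  simp [DNFHolds, or_and_right, exists_or]

theorem dnfHolds_flatMap {α : Type*} {v : ℕ → ℝ} {L : List α}
    {f : α → List (List (Bool × Term))} :
    DNFHolds v (L.flatMap f) ↔ ∃ a ∈ L, DNFHolds v (f a) := by
  simp only [DNFHolds, List.mem_flatMap]
  grind

/-- Conjunction of two disjunctive normal forms. -/
def cross (D E : List (List (Bool × Term))) : List (List (Bool × Term)) :=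
  D.flatMap fun c => E.map fun d => c ++ d

theorem dnfHolds_cross {v : ℕ → ℝ} {D E : List (List (Bool × Term))} :
    DNFHolds v (cross D E) ↔ DNFHolds v D ∧ DNFHolds v E := by
  simp only [DNFHolds, cross, List.mem_flatMap, List.mem_map]
  constructor
  · rintro ⟨_, ⟨c, hc, d, hd, rfl⟩, h⟩
    rw [conjHolds_append] at h
    exact ⟨⟨c, hc, h.1⟩, ⟨d, hd, h.2⟩⟩
  · rintro ⟨⟨c, hc, h1⟩, ⟨d, hd, h2⟩⟩
    exact ⟨_, ⟨c, hc, d, hd, rfl⟩, conjHolds_append.2 ⟨h1, h2⟩⟩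

/-- Negation of a literal. -/
def negLit (l : Bool × Term) : List (List (Bool × Term)) :=
  [[(!l.1, l.2)], [(false, .sub .zero l.2)]]

/-- By trichotomy: in both cases `0 < -t` is one alternative, and the other is the literal of the
opposite kind. -/
theorem dnfHolds_negLit {v : ℕ → ℝ} {l : Bool × Term} :
    DNFHolds v (negLit l) ↔ ¬ LitHolds v l := by
  obtain ⟨b, t⟩ := l
  cases b
  · simp [DNFHolds, negLit, ConjHolds, LitHolds, Term.eval, le_iff_lt_or_eq, or_comm]
  · simpa [DNFHolds, negLit, ConjHolds, LitHolds, Term.eval, or_comm] using ne_comm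

/-- Negation of a disjunctive normal form. -/
def negDNF (D : List (List (Bool × Term))) : List (List (Bool × Term)) :=
  D.foldr (fun c acc => cross (c.flatMap negLit) acc) [[]]

/-- De Morgan: the negation of a clause is the disjunction of its negated literals, and `cross`
distributes the conjunction over clauses. The base `[[]]` is the true formula. -/
theorem dnfHolds_negDNF {v : ℕ → ℝ} {D : List (List (Bool × Term))} :
    DNFHolds v (negDNF D) ↔ ¬ DNFHolds v D := by
  induction D with
  | nil => simp [negDNF, DNFHolds]
  | cons c D ih =>
    have : negDNF (c :: D) = cross (c.flatMap negLit) (negDNF D) := rfl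
    rw [this, dnfHolds_cross, ih, dnfHolds_flatMap, dnfHolds_cons, not_or]
    simp only [dnfHolds_negLit, ConjHolds, not_forall, exists_prop]

/-! ### Univariate polynomials with terms as coefficients. -/

/-- The list `[f 0, …, f (n - 1)]`. -/
def tabulate {α : Type*} (n : ℕ) (f : ℕ → α) : List α := (List.range n).map f

@[simp] theorem length_tabulate {α : Type*} (n : ℕ) (f : ℕ → α) : (tabulate n f).length = n := by
  simp [tabulate]

theorem getD_tabulate {α : Type*} (n : ℕ) (f : ℕ → α) (k : ℕ) (d : α) :
    (tabulate n f).getD k d = if k < n then f k else d := by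
  unfold tabulate
  split_ifs with h <;> simp [List.getD, h]

/-- The univariate polynomial with the given list of coefficients. -/
noncomputable def polyOf (v : ℕ → ℝ) (p : List Term) : ℝ[X] :=
  ∑ k ∈ Finset.range p.length, C ((p.getD k .zero).eval v) * X ^ k

theorem coeff_polyOf (v : ℕ → ℝ) (p : List Term) (k : ℕ) :
    (polyOf v p).coeff k = (p.getD k .zero).eval v := by
  simp only [polyOf, finsetSum_coeff, coeff_C_mul_X_pow]
  rw [Finset.sum_ite_eq]
  split_ifs with h
  · rfl
  · have : p.length ≤ k := by simpa using h
    rw [List.getD_eq_default _ _ this]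
    rfl

theorem polyOf_eq_zero_iff {v : ℕ → ℝ} {p : List Term} :
    polyOf v p = 0 ↔ ∀ t ∈ p, t.eval v = 0 := by
  constructor
  · intro h t ht
    obtain ⟨k, hk, rfl⟩ := List.mem_iff_getElem.1 ht
    have := coeff_polyOf v p k
    rw [h, List.getD_eq_getElem _ _ hk] at this
    simpa using this.symm
  · intro h
    ext k
    rw [coeff_polyOf]
    by_cases hk : k < p.length
    · rw [List.getD_eq_getElem _ _ hk]
      simpa using h _ (List.getElem_mem hk)
    · rw [List.getD_eq_default _ _ (not_lt.1 hk)]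
      rfl

def sumTerm (l : List Term) : Term := l.foldr .add .zero

def prodTerm (l : List Term) : Term := l.foldr .mul .one

theorem eval_sumTerm (v : ℕ → ℝ) (l : List Term) :
    (sumTerm l).eval v = (l.map (Term.eval v)).sum := by
  induction l with
  | nil => rfl
  | cons t l ih => rw [List.map_cons, List.sum_cons, ← ih]; rfl

def addPoly (p q : List Term) : List Term :=
  tabulate (max p.length q.length) fun k => .add (p.getD k .zero) (q.getD k .zero)

def subPoly (p q : List Term) : List Term :=
  tabulate (max p.length q.length) fun k => .sub (p.getD k .zero) (q.getD k .zero)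

/-- The length exceeds what the degree needs. Surplus entries evaluate to zero and are harmless,
because the Euclidean algorithm branches on vanishing top coefficients. -/
def mulPoly (p q : List Term) : List Term :=
  tabulate (p.length + q.length) fun k =>
    sumTerm (tabulate (k + 1) fun a => .mul (p.getD a .zero) (q.getD (k - a) .zero))

theorem polyOf_addPoly (v : ℕ → ℝ) (p q : List Term) :
    polyOf v (addPoly p q) = polyOf v p + polyOf v q := by
  ext k
  rw [coeff_add, coeff_polyOf, coeff_polyOf, coeff_polyOf, addPoly, getD_tabulate]
  split_ifs with h
  · rfl
  · simp only [lt_sup_iff, not_or, not_lt] at h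
    rw [List.getD_eq_default _ _ h.1, List.getD_eq_default _ _ h.2]
    simp [Term.eval]

theorem polyOf_subPoly (v : ℕ → ℝ) (p q : List Term) :
    polyOf v (subPoly p q) = polyOf v p - polyOf v q := by
  ext k
  rw [coeff_sub, coeff_polyOf, coeff_polyOf, coeff_polyOf, subPoly, getD_tabulate]
  split_ifs with h
  · rfl
  · simp only [lt_sup_iff, not_or, not_lt] at h
    rw [List.getD_eq_default _ _ h.1, List.getD_eq_default _ _ h.2]
    simp [Term.eval]

theorem polyOf_mulPoly (v : ℕ → ℝ) (p q : List Term) :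
    polyOf v (mulPoly p q) = polyOf v p * polyOf v q := by
  ext k
  rw [coeff_mul, Finset.Nat.sum_antidiagonal_eq_sum_range_succ_mk, coeff_polyOf, mulPoly,
    getD_tabulate]
  simp only [coeff_polyOf]
  split_ifs with h
  · rw [eval_sumTerm, tabulate, List.map_map]
    rfl
  · simp only [Term.eval]
    refine (Finset.sum_eq_zero fun a ha => ?_).symm
    simp only [Finset.mem_range] at ha
    rcases le_or_gt p.length a with h1 | h1
    · rw [List.getD_eq_default _ _ h1]; simp [Term.eval]
    · rw [List.getD_eq_default q _ (by omega)]; simp [Term.eval]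

/-- The coefficients of a term as a polynomial in the variable `i`. -/
def toPoly (i : ℕ) : Term → List Term
  | .var j => if j = i then [.zero, .one] else [.var j]
  | .zero => []
  | .one => [.one]
  | .add s t => addPoly (toPoly i s) (toPoly i t)
  | .sub s t => subPoly (toPoly i s) (toPoly i t)
  | .mul s t => mulPoly (toPoly i s) (toPoly i t)

theorem polyOf_singleton (v : ℕ → ℝ) (t : Term) : polyOf v [t] = C (t.eval v) := by
  simp [polyOf]

theorem polyOf_toPoly_var (v : ℕ → ℝ) (i j : ℕ) :
    polyOf v (toPoly i (.var j)) = if j = i then X else C (v j) := by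
  unfold toPoly
  split_ifs
  · simp [polyOf, Finset.sum_range_succ, Term.eval]
  · rw [polyOf_singleton]; rfl

theorem eval_polyOf_toPoly (v : ℕ → ℝ) (i : ℕ) (x : ℝ) (t : Term) :
    (polyOf v (toPoly i t)).eval x = t.eval (Function.update v i x) := by
  induction t with
  | var j =>
    rw [polyOf_toPoly_var]
    split_ifs with h
    · simp [h, Term.eval]
    · simp [h, Term.eval]
  | zero => simp [toPoly, polyOf, Term.eval]
  | one => rw [toPoly, polyOf_singleton]; simp [Term.eval]
  | add s t hs ht => rw [toPoly, polyOf_addPoly, eval_add, hs, ht]; rfl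
  | sub s t hs ht => rw [toPoly, polyOf_subPoly, eval_sub, hs, ht]; rfl
  | mul s t hs ht => rw [toPoly, polyOf_mulPoly, eval_mul, hs, ht]; rfl

/-- The formal derivative of a term with respect to the variable `i`. -/
def deriv (i : ℕ) : Term → Term
  | .var j => if j = i then .one else .zero
  | .zero => .zero
  | .one => .zero
  | .add s t => .add (deriv i s) (deriv i t)
  | .sub s t => .sub (deriv i s) (deriv i t)
  | .mul s t => .add (.mul (deriv i s) t) (.mul s (deriv i t))

theorem polyOf_toPoly_deriv (v : ℕ → ℝ) (i : ℕ) (t : Term) :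
    polyOf v (toPoly i (deriv i t)) = derivative (polyOf v (toPoly i t)) := by
  have h0 : polyOf v (toPoly i .zero) = 0 := by simp [toPoly, polyOf]
  have h1 : polyOf v (toPoly i .one) = 1 := by
    rw [toPoly, polyOf_singleton]; simp [Term.eval]
  induction t with
  | var j =>
    rw [polyOf_toPoly_var, deriv]
    split_ifs <;> simp [h0, h1]
  | zero => rw [deriv, h0, derivative_zero]
  | one => rw [deriv, h0, h1, derivative_one]
  | add s t hs ht => simp only [deriv, toPoly, polyOf_addPoly, hs, ht, derivative_add]
  | sub s t hs ht => simp only [deriv, toPoly, polyOf_subPoly, hs, ht, derivative_sub]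
  | mul s t hs ht =>
    simp only [deriv, toPoly, polyOf_addPoly, polyOf_mulPoly, hs, ht, derivative_mul]

/-! ### Pseudo-division and one Euclidean step. -/

/-- The candidate for the leading coefficient. -/
def lead (p : List Term) : Term := p.getD (p.length - 1) .zero

/-- The polynomial without its top coefficient. -/
def dropLead (p : List Term) : List Term := tabulate (p.length - 1) fun k => p.getD k .zero

/-- The polynomial `c q - d X ^ k p`, where `k` is the difference of the lengths, without its
top coefficient. -/
def reduce (c d : Term) (p q : List Term) : List Term :=
  tabulate (q.length - 1) fun k =>
    .sub (.mul c (q.getD k .zero))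
      (if k < q.length - p.length then .zero
        else .mul d (p.getD (k - (q.length - p.length)) .zero))

theorem polyOf_dropLead {v : ℕ → ℝ} {p : List Term} (h : (lead p).eval v = 0) :
    polyOf v (dropLead p) = polyOf v p := by
  ext k
  rw [coeff_polyOf, coeff_polyOf, dropLead, getD_tabulate]
  split_ifs with hk
  · rfl
  · rcases eq_or_ne k (p.length - 1) with rfl | hne
    · exact h.symm
    · rw [List.getD_eq_default _ _ (by omega)]

theorem polyOf_reduce {v : ℕ → ℝ} {c d : Term} {p q : List Term} (hp : p ≠ [])
    (hpq : p.length ≤ q.length) (h : c.eval v * (lead q).eval v = d.eval v * (lead p).eval v) :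
    polyOf v (reduce c d p q) = C (c.eval v) * polyOf v q -
      C (d.eval v) * (X ^ (q.length - p.length) * polyOf v p) := by
  have hp1 : 0 < p.length := List.length_pos_iff.2 hp
  ext k
  rw [coeff_sub, coeff_C_mul, coeff_C_mul, coeff_X_pow_mul', coeff_polyOf, coeff_polyOf,
    coeff_polyOf, reduce, getD_tabulate]
  split_ifs with h1 h2 h3 h3
  · omega
  · simp [Term.eval]
  · simp [Term.eval]
  · omega
  -- The coefficient omitted by `reduce` is the one that cancels by `h`.
  · rcases eq_or_ne k (q.length - 1) with rfl | hne
    · rw [show q.length - 1 - (q.length - p.length) = p.length - 1 by omega]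
      simp only [Term.eval]
      simp only [lead] at h
      linarith
    · rw [List.getD_eq_default _ _ (by omega), List.getD_eq_default p _ (by omega)]
      simp [Term.eval]
  · omega

theorem natDegree_leadingCoeff_polyOf {v : ℕ → ℝ} {p : List Term} (h : (lead p).eval v ≠ 0) :
    (polyOf v p).natDegree = p.length - 1 ∧ (polyOf v p).leadingCoeff = (lead p).eval v := by
  have hd : (polyOf v p).natDegree = p.length - 1 := by
    refine natDegree_eq_of_le_of_coeff_ne_zero ?_ (by rw [coeff_polyOf]; exact h)
    rw [natDegree_le_iff_coeff_eq_zero]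
    intro k hk
    rw [coeff_polyOf, List.getD_eq_default _ _ (by omega)]
    rfl
  exact ⟨hd, by rw [leadingCoeff, hd, coeff_polyOf]; rfl⟩

/-- One step of the Euclidean algorithm for Cauchy indices. -/
def euclid (p q : List Term) : List Term × List Term :=
  if p.length ≤ q.length then
    (p, reduce (.mul (lead p) (lead p)) (.mul (lead p) (lead q)) p q)
  else
    (q, reduce (.sub .zero (.mul (lead q) (lead q))) (.sub .zero (.mul (lead q) (lead p))) q p)

/-- Whether a step of the Euclidean algorithm changes the Cauchy index, as a number. -/
def flips (p q : List Term) : ℕ :=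
  if p.length ≤ q.length then 0 else (p.length + q.length) % 2

/-- If `q` is at least as long as `p`, it is scaled by the square of `lead p` and reduced modulo
`p`. Otherwise the inversion formula exchanges the two; its minus sign is absorbed by the negative
multiplier `-(lead q)²`, and its right-hand side is the correction counted by `flips`. -/
theorem cauchyIndex_euclid {v : ℕ → ℝ} {p q : List Term} (hp : p ≠ []) (hq : q ≠ [])
    (hlp : (lead p).eval v ≠ 0) (hlq : (lead q).eval v ≠ 0) :
    cauchyIndex (polyOf v p) (polyOf v q) =
      cauchyIndex (polyOf v (euclid p q).1) (polyOf v (euclid p q).2) +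
        flips p q * (SignType.sign ((lead p).eval v * (lead q).eval v) : ℤ) := by
  have hp1 : 0 < p.length := List.length_pos_iff.2 hp
  have hq1 : 0 < q.length := List.length_pos_iff.2 hq
  unfold euclid flips
  split_ifs with h
  · simp only
    rw [polyOf_reduce hp h (by simp only [Term.eval]; ring), Nat.cast_zero, zero_mul, add_zero,
      ← cauchyIndex_mul_add (polyOf v p) (polyOf v q)
        (-(C ((Term.mul (lead p) (lead q)).eval v) * X ^ (q.length - p.length)))
        (mul_self_pos.2 hlp)]
    congr 1
    simp only [Term.eval]
    ring
  · simp only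
    rw [polyOf_reduce hq (by omega) (by simp only [Term.eval]; ring)]
    obtain ⟨hdp, hcp⟩ := natDegree_leadingCoeff_polyOf hlp
    obtain ⟨hdq, hcq⟩ := natDegree_leadingCoeff_polyOf hlq
    have hp0 : polyOf v p ≠ 0 := by rw [← leadingCoeff_ne_zero, hcp]; exact hlp
    have hq0 : polyOf v q ≠ 0 := by rw [← leadingCoeff_ne_zero, hcq]; exact hlq
    have hswap := cauchyIndex_add_cauchyIndex hp0 hq0
    rw [hdp, hdq, hcp, hcq] at hswap
    have hred : cauchyIndex (polyOf v q) (C ((Term.sub .zero (.mul (lead q) (lead q))).eval v) *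
        polyOf v p - C ((Term.sub .zero (.mul (lead q) (lead p))).eval v) *
          (X ^ (p.length - q.length) * polyOf v q)) =
        - cauchyIndex (polyOf v q) (polyOf v p) := by
      rw [← cauchyIndex_mul_add (polyOf v q) (polyOf v p)
        (-(C ((Term.mul (lead q) (lead p)).eval v) * X ^ (p.length - q.length)))
        (mul_self_pos.2 hlq), ← cauchyIndex_neg_right]
      congr 1
      simp only [Term.eval, zero_sub, map_neg]
      ring
    rw [hred]
    -- Each length is the degree plus one, so the sum of the lengths has the parity of the sum of
    -- the degrees.
    have hpar : ((if Odd (p.length - 1 + (q.length - 1)) then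
        (SignType.sign ((lead p).eval v * (lead q).eval v) : ℤ) else 0)) =
        ((p.length + q.length) % 2 : ℕ) *
          (SignType.sign ((lead p).eval v * (lead q).eval v) : ℤ) := by
      split_ifs with ho
      · rw [show (p.length + q.length) % 2 = 1 by rw [Nat.odd_iff] at ho; omega]
        simp
      · rw [show (p.length + q.length) % 2 = 0 by rw [Nat.odd_iff] at ho; omega]
        simp
    rw [← hpar]
    linarith

theorem length_euclid {p q : List Term} (hp : p ≠ []) (hq : q ≠ []) :
    (euclid p q).1.length + (euclid p q).2.length + 1 = p.length + q.length := by
  have hp1 : 0 < p.length := List.length_pos_iff.2 hp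
  have hq1 : 0 < q.length := List.length_pos_iff.2 hq
  unfold euclid reduce
  split_ifs <;> simp only [length_tabulate] <;> omega

end RealFO

/-! ### Symbolic computation of sums of Cauchy indices. -/

namespace RealFO

open Polynomial

/-- One step of the computation of a sum of Cauchy indices by Euclidean algorithms, branching on
the signs of the leading coefficients. A state consists of the assumptions made so far, the pending
pairs of polynomials, and two counters whose difference has been obtained so far. -/
def step (s : List (Bool × Term) × List (List Term × List Term) × ℕ × ℕ) :
    List (List (Bool × Term) × List (List Term × List Term) × ℕ × ℕ) :=
  match s.2.1 with
  | [] => [s]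
  | pq :: r =>
    if pq.1.length = 0 ∨ pq.2.length = 0 then [(s.1, r, s.2.2)]
    else
      [((true, lead pq.1) :: s.1, (dropLead pq.1, pq.2) :: r, s.2.2),
        ((true, lead pq.2) :: s.1, (pq.1, dropLead pq.2) :: r, s.2.2),
        ((false, .mul (lead pq.1) (lead pq.2)) :: s.1, euclid pq.1 pq.2 :: r,
          s.2.2.1 + flips pq.1 pq.2, s.2.2.2),
        ((false, .sub .zero (.mul (lead pq.1) (lead pq.2))) :: s.1, euclid pq.1 pq.2 :: r,
          s.2.2.1, s.2.2.2 + flips pq.1 pq.2)]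

/-- A bound for the number of steps. -/
def fuel (L : List (List Term × List Term)) : ℕ :=
  L.foldr (fun pq n => pq.1.length + pq.2.length + 1 + n) 0

/-- The sum of the Cauchy indices of a list of pairs of polynomials. -/
noncomputable def indexSum (v : ℕ → ℝ) (L : List (List Term × List Term)) : ℤ :=
  (L.map fun pq => cauchyIndex (polyOf v pq.1) (polyOf v pq.2)).sum

/-- The integer computed from a state. -/
noncomputable def stateValue (v : ℕ → ℝ)
    (s : List (Bool × Term) × List (List Term × List Term) × ℕ × ℕ) : ℤ :=
  s.2.2.1 - s.2.2.2 + indexSum v s.2.1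

theorem indexSum_cons (v : ℕ → ℝ) (pq : List Term × List Term)
    (L : List (List Term × List Term)) :
    indexSum v (pq :: L) = cauchyIndex (polyOf v pq.1) (polyOf v pq.2) + indexSum v L := by
  simp [indexSum]

theorem polyOf_nil (v : ℕ → ℝ) : polyOf v [] = 0 := by simp [polyOf]

/-- Every branch shortens the first pending pair by one entry or discards it; the extra unit per
pair in `fuel` pays for the discarding step. -/
theorem fuel_of_mem_step {s s' : List (Bool × Term) × List (List Term × List Term) × ℕ × ℕ}
    (h : s' ∈ step s) : fuel s'.2.1 ≤ fuel s.2.1 - 1 := by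
  obtain ⟨g, L, m, n⟩ := s
  cases L with
  | nil =>
    simp only [step, List.mem_singleton] at h
    rw [h]
    simp [fuel]
  | cons pq r =>
    have hf : ∀ (x : List Term × List Term), fuel (x :: r) =
      x.1.length + x.2.length + 1 + fuel r := fun _ => rfl
    simp only [step] at h
    split_ifs at h with h0
    · simp only [List.mem_singleton] at h
      rw [h]
      simp only [hf]
      omega
    · simp only [not_or] at h0
      have he := length_euclid (p := pq.1) (q := pq.2) (by grind) (by grind)
      simp only [List.mem_cons, List.not_mem_nil, or_false] at h
      rcases h with rfl | rfl | rfl | rfl <;> simp only [hf, dropLead, length_tabulate] <;> omega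

theorem conjHolds_of_mem_step {v : ℕ → ℝ}
    {s s' : List (Bool × Term) × List (List Term × List Term) × ℕ × ℕ}
    (h : s' ∈ step s) (hs : ConjHolds v s'.1) : ConjHolds v s.1 := by
  obtain ⟨g, L, m, n⟩ := s
  cases L with
  | nil =>
    simp only [step, List.mem_singleton] at h
    rwa [h] at hs
  | cons pq r =>
    simp only [step] at h
    split_ifs at h with h0
    · simp only [List.mem_singleton] at h
      rwa [h] at hs
    · simp only [List.mem_cons, List.not_mem_nil, or_false] at h
      rcases h with rfl | rfl | rfl | rfl <;> exact (conjHolds_cons.1 hs).2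

/-- The guards are exhaustive by trichotomy for the product of the two leading candidates. They may
overlap when both candidates vanish. -/
theorem exists_mem_step {v : ℕ → ℝ}
    {s : List (Bool × Term) × List (List Term × List Term) × ℕ × ℕ}
    (hs : ConjHolds v s.1) : ∃ s' ∈ step s, ConjHolds v s'.1 := by
  obtain ⟨g, L, m, n⟩ := s
  cases L with
  | nil => exact ⟨_, List.mem_singleton_self _, hs⟩
  | cons pq r =>
    simp only [step]
    split_ifs with h0
    · exact ⟨_, List.mem_singleton_self _, hs⟩
    · have hs' : ConjHolds v g := hs
      simp only [List.mem_cons, List.not_mem_nil, or_false, exists_eq_or_imp, exists_eq_left,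
        conjHolds_cons, LitHolds, Term.eval]
      rcases lt_trichotomy ((lead pq.1).eval v * (lead pq.2).eval v) 0 with h | h | h
      · simp [h, hs']
      · rcases mul_eq_zero.1 h with h | h <;> simp [h, hs']
      · simp [h, hs']

/-- Dropping a vanishing top coefficient changes no polynomial, and a pair with an empty list has
index zero. In a Euclidean step the guard fixes the sign of the correction, hence the counter that
receives it. -/
theorem stateValue_of_mem_step {v : ℕ → ℝ}
    {s s' : List (Bool × Term) × List (List Term × List Term) × ℕ × ℕ}
    (h : s' ∈ step s) (hs : ConjHolds v s'.1) : stateValue v s' = stateValue v s := by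
  obtain ⟨g, L, m, n⟩ := s
  cases L with
  | nil =>
    simp only [step, List.mem_singleton] at h
    rw [h]
  | cons pq r =>
    simp only [step] at h
    split_ifs at h with h0
    · simp only [List.mem_singleton] at h
      rw [h]
      simp only [stateValue, indexSum_cons]
      rcases h0 with h0 | h0 <;> rw [List.length_eq_zero_iff] at h0 <;> simp [h0, polyOf_nil]
    · simp only [List.mem_cons, List.not_mem_nil, or_false] at h
      simp only [not_or, List.length_eq_zero_iff] at h0
      rcases h with rfl | rfl | rfl | rfl <;> have hl := (conjHolds_cons.1 hs).1 <;>
        simp only [LitHolds, Term.eval, if_true, Bool.false_eq_true, if_false, zero_sub,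
          Left.neg_pos_iff] at hl <;>
        simp only [stateValue, indexSum_cons]
      · rw [polyOf_dropLead hl]
      · rw [polyOf_dropLead hl]
      · rw [cauchyIndex_euclid (v := v) h0.1 h0.2 (left_ne_zero_of_mul hl.ne')
          (right_ne_zero_of_mul hl.ne'), sign_pos hl]
        push_cast
        simp
        ring
      · rw [cauchyIndex_euclid (v := v) h0.1 h0.2 (left_ne_zero_of_mul hl.ne)
          (right_ne_zero_of_mul hl.ne), sign_neg hl]
        push_cast
        simp
        ring

/-- All states reached by the computation. -/
def run (L : List (List Term × List Term)) :
    List (List (Bool × Term) × List (List Term × List Term) × ℕ × ℕ) :=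
  (fun S => S.flatMap step)^[fuel L] [([], L, 0, 0)]

/-- The condition that a sum of Cauchy indices is positive. -/
def indexSumPos (L : List (List Term × List Term)) : List (List (Bool × Term)) :=
  (run L).flatMap fun s => if s.2.2.2 < s.2.2.1 then [s.1] else []

/-- Every reached state whose assumptions hold carries the right value, and some reached state has
true assumptions. After `fuel L` steps no pairs are pending, so the value is the difference of the
counters. Overlapping guards do no harm, since all true states agree. -/
theorem dnfHolds_indexSumPos {v : ℕ → ℝ} {L : List (List Term × List Term)} :
    DNFHolds v (indexSumPos L) ↔ 0 < indexSum v L := by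
  have inv : ∀ k,
      (∀ s ∈ (fun S => S.flatMap step)^[k] [([], L, 0, 0)], fuel s.2.1 ≤ fuel L - k ∧
        (ConjHolds v s.1 → stateValue v s = indexSum v L)) ∧
      ∃ s ∈ (fun S => S.flatMap step)^[k] [([], L, 0, 0)], ConjHolds v s.1 := by
    intro k
    induction k with
    | zero => simp [stateValue]
    | succ k ih =>
      rw [Function.iterate_succ_apply']
      simp only [List.mem_flatMap]
      refine ⟨?_, ?_⟩
      · rintro s' ⟨s, hs, hs'⟩
        obtain ⟨h1, h2⟩ := ih.1 s hs
        refine ⟨?_, fun hc => ?_⟩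
        · have := fuel_of_mem_step hs'
          omega
        · rw [stateValue_of_mem_step hs' hc]
          exact h2 (conjHolds_of_mem_step hs' hc)
      · obtain ⟨s, hs, hc⟩ := ih.2
        obtain ⟨s', hs', hc'⟩ := exists_mem_step hc
        exact ⟨s', ⟨s, hs, hs'⟩, hc'⟩
  obtain ⟨hall, hex⟩ := inv (fuel L)
  have hval : ∀ s ∈ run L, ConjHolds v s.1 → ((s.2.2.1 : ℤ) - s.2.2.2 = indexSum v L) := by
    intro s hs hc
    obtain ⟨h1, h2⟩ := hall s hs
    have : s.2.1 = [] := by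
      rcases hL : s.2.1 with _ | ⟨pq, r⟩
      · rfl
      · rw [hL] at h1
        simp [fuel] at h1
    rw [← h2 hc, stateValue, this]
    simp [indexSum]
  rw [indexSumPos, dnfHolds_flatMap]
  constructor
  · rintro ⟨s, hs, h⟩
    split_ifs at h with hlt
    · have := hval s hs (by simpa [DNFHolds] using h)
      omega
    · simp [DNFHolds] at h
  · intro h
    obtain ⟨s, hs, hc⟩ := hex
    refine ⟨s, hs, ?_⟩
    have := hval s hs hc
    rw [if_pos (by omega)]
    simpa [DNFHolds] using hc

/-- All products in which each factor occurs once or twice. -/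
def products (qs : List Term) : List Term :=
  qs.foldr (fun q acc => acc.flatMap fun r => [.mul q r, .mul (.mul q q) r]) [.one]

/-- The sum factors as `∏ (σ + σ²)`, where `σ` runs through the signs of the `qs`; a factor is `2`
for `σ = 1` and `0` otherwise. -/
theorem sum_sign_products (w : ℕ → ℝ) (qs : List Term) :
    ((products qs).map fun r => (SignType.sign (r.eval w) : ℤ)).sum =
      if ∀ q ∈ qs, 0 < q.eval w then 2 ^ qs.length else 0 := by
  induction qs with
  | nil => simp [products, Term.eval]
  | cons q qs ih =>
    have hcons : products (q :: qs) =
      (products qs).flatMap fun r => [.mul q r, .mul (.mul q q) r] := rfl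
    have hgen : ∀ l : List Term,
        ((l.flatMap fun r => [Term.mul q r, .mul (.mul q q) r]).map
          fun r => (SignType.sign (r.eval w) : ℤ)).sum =
        ((SignType.sign (q.eval w) : ℤ) + SignType.sign (q.eval w) * SignType.sign (q.eval w)) *
          (l.map fun r => (SignType.sign (r.eval w) : ℤ)).sum := by
      intro l
      induction l with
      | nil => simp
      | cons r l ihl =>
        simp only [List.flatMap_cons, List.map_append, List.sum_append, ihl, List.map_cons,
          List.sum_cons, List.map_nil, List.sum_nil, Term.eval, sign_mul, SignType.coe_mul]
        ring
    rw [hcons, hgen, ih]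
    simp only [List.forall_mem_cons]
    rcases lt_trichotomy (q.eval w) 0 with h | h | h
    · simp [h, h.le.not_gt]
    · simp [h]
    · simp only [h, sign_pos, true_and, SignType.coe_one, List.length_cons]
      split_ifs <;> ring

/-- The condition that `P` is not the zero polynomial in the variable `i` and has a root at which
all `qs` are positive. -/
def rootDNF (i : ℕ) (P : Term) (qs : List Term) : List (List (Bool × Term)) :=
  indexSumPos ((products qs).map fun r => (toPoly i P, toPoly i (.mul (deriv i P) r)))

/-- After exchanging the two sums, the index sum is `2 ^ qs.length` times the number of distinct
roots of `p` at which all `qs` are positive. For `p = 0` it is zero, so positivity also yields `p ≠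
0`. -/
theorem dnfHolds_rootDNF {v : ℕ → ℝ} {i : ℕ} {P : Term} {qs : List Term} :
    DNFHolds v (rootDNF i P qs) ↔ polyOf v (toPoly i P) ≠ 0 ∧
      ∃ x : ℝ, P.eval (Function.update v i x) = 0 ∧
        ∀ q ∈ qs, 0 < q.eval (Function.update v i x) := by
  rw [rootDNF, dnfHolds_indexSumPos, indexSum, List.map_map]
  set p := polyOf v (toPoly i P) with hp
  have hmap : ((fun pq : List Term × List Term => cauchyIndex (polyOf v pq.1) (polyOf v pq.2)) ∘
      fun r => (toPoly i P, toPoly i (.mul (deriv i P) r))) =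
      fun r => ∑ x ∈ p.roots.toFinset, (SignType.sign (r.eval (Function.update v i x)) : ℤ) := by
    funext r
    simp only [Function.comp, toPoly, polyOf_mulPoly, polyOf_toPoly_deriv,
      cauchyIndex_derivative_mul, eval_polyOf_toPoly]
    rfl
  have hcomm : ∀ l : List Term,
      (l.map fun r => ∑ x ∈ p.roots.toFinset,
        (SignType.sign (r.eval (Function.update v i x)) : ℤ)).sum =
      ∑ x ∈ p.roots.toFinset,
        (l.map fun r => (SignType.sign (r.eval (Function.update v i x)) : ℤ)).sum := by
    intro l
    induction l with
    | nil => simp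
    | cons r l ih => simp only [List.map_cons, List.sum_cons, ih, Finset.sum_add_distrib]
  rw [hmap, hcomm]
  simp only [sum_sign_products]
  have hnn : ∀ x ∈ p.roots.toFinset, (0 : ℤ) ≤
      if ∀ q ∈ qs, 0 < q.eval (Function.update v i x) then 2 ^ qs.length else 0 := by
    intro x _
    split_ifs <;> positivity
  rw [Finset.sum_pos_iff_of_nonneg hnn]
  constructor
  · rintro ⟨x, hx, h⟩
    have hp0 : p ≠ 0 := by rintro h0; simp [h0] at hx
    have hroot : p.eval x = 0 := by simpa [hp0] using hx
    refine ⟨hp0, x, ?_, ?_⟩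
    · rw [← eval_polyOf_toPoly]; exact hroot
    · by_contra hc
      rw [if_neg hc] at h
      exact lt_irrefl _ h
  · rintro ⟨hp0, x, hx, hq⟩
    refine ⟨x, ?_, ?_⟩
    · rw [← eval_polyOf_toPoly] at hx
      simpa [hp0] using hx
    · rw [if_pos hq]
      positivity

/-! ### Elimination of one existential quantifier. -/

/-- The numerator of the derivative of `Q / (1 + (x Q) ^ 2)` with respect to `x`, the variable with
index `i`. -/
def criticalTerm (i : ℕ) (Q : Term) : Term :=
  .sub (.mul (deriv i Q) (.add .one (.mul (.mul (.var i) Q) (.mul (.var i) Q))))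
    (.mul Q (deriv i (.add .one (.mul (.mul (.var i) Q) (.mul (.var i) Q)))))

theorem polyOf_prodTerm (v : ℕ → ℝ) (i : ℕ) (qs : List Term) :
    polyOf v (toPoly i (prodTerm qs)) = (qs.map fun q => polyOf v (toPoly i q)).prod := by
  induction qs with
  | nil =>
    change polyOf v (toPoly i .one) = 1
    rw [toPoly, polyOf_singleton]
    simp [Term.eval]
  | cons q qs ih =>
    rw [List.map_cons, List.prod_cons, ← ih]
    exact polyOf_mulPoly v _ _

/-- Elimination of `∃ x_i` in front of a conjunction of literals. -/
def elimConj (i : ℕ) (c : List (Bool × Term)) : List (List (Bool × Term)) :=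
  let P := sumTerm ((c.filter fun l => l.1 = true).map fun l => .mul l.2 l.2)
  let qs := (c.filter fun l => l.1 = false).map fun l => l.2
  rootDNF i P qs ++
    cross [(toPoly i P).map fun t => (true, t)] (rootDNF i (criticalTerm i (prodTerm qs)) qs)

theorem eval_sumTerm_squares_nonneg (w : ℕ → ℝ) (l : List (Bool × Term)) :
    0 ≤ (sumTerm (l.map fun l => .mul l.2 l.2)).eval w := by
  induction l with
  | nil => exact le_refl _
  | cons a l ih => exact add_nonneg (mul_self_nonneg _) ih

theorem conjHolds_iff_eval_eq_zero (w : ℕ → ℝ) (c : List (Bool × Term)) :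
    ConjHolds w c ↔
      (sumTerm ((c.filter fun l => l.1 = true).map fun l => .mul l.2 l.2)).eval w = 0 ∧
      ∀ q ∈ (c.filter fun l => l.1 = false).map fun l => l.2, 0 < q.eval w := by
  induction c with
  | nil => simp [sumTerm, Term.eval]
  | cons l c ih =>
    obtain ⟨b, t⟩ := l
    rw [conjHolds_cons, ih]
    cases b
    · simp [LitHolds]
      tauto
    · have hadd : (sumTerm ((((true, t) :: c).filter fun l => l.1 = true).map
          fun l => .mul l.2 l.2)).eval w = t.eval w * t.eval w +
          (sumTerm ((c.filter fun l => l.1 = true).map fun l => .mul l.2 l.2)).eval w := by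
        simp [sumTerm, Term.eval]
      rw [hadd, add_eq_zero_iff_of_nonneg (mul_self_nonneg _) 
        (eval_sumTerm_squares_nonneg w _), mul_self_eq_zero]
      simp [LitHolds]
      tauto

/-- If `P` is nonzero as a polynomial in the variable `i`, the first disjunct decides. If it is
zero, the equations hold for every `x`, and any point where the `qs` are positive can be moved to a
root of the critical polynomial. -/
theorem dnfHolds_elimConj {v : ℕ → ℝ} {i : ℕ} {c : List (Bool × Term)} :
    DNFHolds v (elimConj i c) ↔ ∃ x : ℝ, ConjHolds (Function.update v i x) c := by
  simp only [conjHolds_iff_eval_eq_zero]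
  unfold elimConj
  set P := sumTerm ((c.filter fun l => l.1 = true).map fun l => .mul l.2 l.2)
  set qs := (c.filter fun l => l.1 = false).map fun l => l.2
  simp only [dnfHolds_append, dnfHolds_cross, dnfHolds_rootDNF]
  have hz : DNFHolds v [(toPoly i P).map fun t => (true, t)] ↔ polyOf v (toPoly i P) = 0 := by
    rw [polyOf_eq_zero_iff]
    simp [DNFHolds, ConjHolds, LitHolds]
  rw [hz]
  by_cases h0 : polyOf v (toPoly i P) = 0
  · have hP : ∀ x : ℝ, P.eval (Function.update v i x) = 0 := fun x => by
      rw [← eval_polyOf_toPoly, h0, eval_zero]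
    simp only [h0, ne_eq, not_true_eq_false, false_and, false_or, true_and, hP]
    constructor
    · rintro ⟨-, x, -, h⟩
      exact ⟨x, h⟩
    · rintro ⟨x, h⟩
      have hR : polyOf v (toPoly i (criticalTerm i (prodTerm qs))) =
          derivative (qs.map fun q => polyOf v (toPoly i q)).prod *
            (1 + (X * (qs.map fun q => polyOf v (toPoly i q)).prod) *
              (X * (qs.map fun q => polyOf v (toPoly i q)).prod)) -
          (qs.map fun q => polyOf v (toPoly i q)).prod *
            derivative (1 + (X * (qs.map fun q => polyOf v (toPoly i q)).prod) *
              (X * (qs.map fun q => polyOf v (toPoly i q)).prod)) := by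
        have h1 : polyOf v (toPoly i .one) = 1 := by
          rw [toPoly, polyOf_singleton]; simp [Term.eval]
        have hadd : ∀ s t, polyOf v (toPoly i (.add s t)) =
          polyOf v (toPoly i s) + polyOf v (toPoly i t) := fun s t => polyOf_addPoly v _ _
        have hsub : ∀ s t, polyOf v (toPoly i (.sub s t)) =
          polyOf v (toPoly i s) - polyOf v (toPoly i t) := fun s t => polyOf_subPoly v _ _
        have hmul : ∀ s t, polyOf v (toPoly i (.mul s t)) =
          polyOf v (toPoly i s) * polyOf v (toPoly i t) := fun s t => polyOf_mulPoly v _ _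
        rw [criticalTerm, hsub, hmul, hmul, polyOf_toPoly_deriv, polyOf_toPoly_deriv, hadd, hmul,
          hmul, h1, polyOf_prodTerm, polyOf_toPoly_var, if_pos rfl]
      obtain ⟨hne, y, hy, hpos⟩ := exists_common_pos_critical
        (qs.map fun q => polyOf v (toPoly i q)) (x₀ := x) (by
          intro q hq
          obtain ⟨t, ht, rfl⟩ := List.mem_map.1 hq
          rw [eval_polyOf_toPoly]
          exact h t ht)
      rw [← hR] at hne hy
      rw [eval_polyOf_toPoly] at hy
      refine ⟨hne, y, hy, fun q hq => ?_⟩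
      rw [← eval_polyOf_toPoly]
      exact hpos _ (List.mem_map_of_mem hq)
  · simp [h0]

/-! ### Elimination for arbitrary formulas. -/

/-- A disjunctive normal form of an atomic formula. -/
def relDNF (r : Rel) (d e : Term) : List (List (Bool × Term)) :=
  match r with
  | .le => [[(true, d)], [(false, e)]]
  | .lt => [[(false, e)]]
  | .ge => [[(true, d)], [(false, d)]]
  | .gt => [[(false, d)]]
  | .eq => [[(true, d)]]
  | .ne => [[(false, d)], [(false, e)]]

theorem dnfHolds_relDNF (v : ℕ → ℝ) (r : Rel) (s t : Term) :
    DNFHolds v (relDNF r (.sub s t) (.sub t s)) ↔ r.Holds (s.eval v) (t.eval v) := by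
  cases r <;> simp only [relDNF, dnfHolds_cons, conjHolds_cons, conjHolds_nil, LitHolds, Term.eval,
    Rel.Holds, if_true, Bool.false_eq_true, if_false, sub_eq_zero, sub_pos, and_true, dnfHolds_nil,
    or_false]
  · exact le_iff_eq_or_lt.symm
  · rw [ge_iff_le, le_iff_eq_or_lt, eq_comm]
  · rw [ne_iff_lt_or_gt, or_comm]

/-- An equivalent quantifier-free formula in disjunctive normal form. -/
def Formula.dnf : Formula → List (List (Bool × Term))
  | .rel r s t => relDNF r (.sub s t) (.sub t s)
  | .and A B => cross A.dnf B.dnf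
  | .or A B => A.dnf ++ B.dnf
  | .not A => negDNF A.dnf
  | .iff A B => cross A.dnf B.dnf ++ cross (negDNF A.dnf) (negDNF B.dnf)
  | .all i A => negDNF ((negDNF A.dnf).flatMap (elimConj i))
  | .ex i A => A.dnf.flatMap (elimConj i)

theorem dnfHolds_flatMap_elimConj {v : ℕ → ℝ} {i : ℕ} {D : List (List (Bool × Term))} :
    DNFHolds v (D.flatMap (elimConj i)) ↔ ∃ x : ℝ, DNFHolds (Function.update v i x) D := by
  rw [dnfHolds_flatMap]
  simp only [dnfHolds_elimConj]
  constructor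
  · rintro ⟨c, hc, x, h⟩
    exact ⟨x, c, hc, h⟩
  · rintro ⟨x, c, hc, h⟩
    exact ⟨c, hc, x, h⟩

theorem dnfHolds_dnf (A : Formula) (v : ℕ → ℝ) : DNFHolds v A.dnf ↔ A.Holds v := by
  induction A generalizing v with
  | rel r s t => exact dnfHolds_relDNF v r s t
  | and A B hA hB => rw [Formula.dnf, dnfHolds_cross, hA, hB]; rfl
  | or A B hA hB => rw [Formula.dnf, dnfHolds_append, hA, hB]; rfl
  | not A hA => rw [Formula.dnf, dnfHolds_negDNF, hA]; rfl
  | iff A B hA hB =>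
    simp only [Formula.dnf, dnfHolds_append, dnfHolds_cross, dnfHolds_negDNF, hA, hB,
      Formula.Holds]
    tauto
  | all i A hA =>
    simp only [Formula.dnf, dnfHolds_negDNF, dnfHolds_flatMap_elimConj, hA, Formula.Holds]
    push Not
    rfl
  | ex i A hA =>
    simp only [Formula.dnf, dnfHolds_flatMap_elimConj, hA, Formula.Holds]

/-! ### Restriction to the free variables. -/

/-- Replace by `0` all variables that are not in the list. -/
def Term.restrict (L : List ℕ) : Term → Term
  | .var j => if j ∈ L then .var j else .zero
  | .zero => .zero
  | .one => .one
  | .add s t => .add (s.restrict L) (t.restrict L)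
  | .sub s t => .sub (s.restrict L) (t.restrict L)
  | .mul s t => .mul (s.restrict L) (t.restrict L)

theorem Term.eval_restrict (L : List ℕ) (v : ℕ → ℝ) (t : Term) :
    (t.restrict L).eval v = t.eval fun j => if j ∈ L then v j else 0 := by
  induction t with
  | var j =>
    simp only [Term.restrict, Term.eval]
    split_ifs <;> rfl
  | zero => rfl
  | one => rfl
  | add s t hs ht => simp only [Term.restrict, Term.eval, hs, ht]
  | sub s t hs ht => simp only [Term.restrict, Term.eval, hs, ht]
  | mul s t hs ht => simp only [Term.restrict, Term.eval, hs, ht]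

theorem Term.vars_restrict (L : List ℕ) (t : Term) : (t.restrict L).vars ⊆ L.toFinset := by
  induction t with
  | var j =>
    simp only [Term.restrict]
    split_ifs with h <;> simp [Term.vars, h]
  | zero => simp [Term.restrict, Term.vars]
  | one => simp [Term.restrict, Term.vars]
  | add s t hs ht => exact Finset.union_subset hs ht
  | sub s t hs ht => exact Finset.union_subset hs ht
  | mul s t hs ht => exact Finset.union_subset hs ht

def Term.varList : Term → List ℕ
  | .var i => [i]
  | .zero => []
  | .one => []
  | .add s t => s.varList ++ t.varList
  | .sub s t => s.varList ++ t.varList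
  | .mul s t => s.varList ++ t.varList

theorem Term.toFinset_varList (t : Term) : t.varList.toFinset = t.vars := by
  induction t <;> simp_all [Term.varList, Term.vars]

def Formula.freeVarList : Formula → List ℕ
  | .rel _ s t => s.varList ++ t.varList
  | .and A B => A.freeVarList ++ B.freeVarList
  | .or A B => A.freeVarList ++ B.freeVarList
  | .not A => A.freeVarList
  | .iff A B => A.freeVarList ++ B.freeVarList
  | .all i A => A.freeVarList.flatMap fun j => if j = i then [] else [j]
  | .ex i A => A.freeVarList.flatMap fun j => if j = i then [] else [j]

theorem mem_flatMap_ite {L : List ℕ} {i j : ℕ} :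
    (j ∈ L.flatMap fun j => if j = i then [] else [j]) ↔ j ≠ i ∧ j ∈ L := by
  rw [List.mem_flatMap]
  constructor
  · rintro ⟨a, ha, h⟩
    split_ifs at h with hai
    · simp at h
    · rw [List.mem_singleton] at h
      subst h
      exact ⟨hai, ha⟩
  · rintro ⟨h1, h2⟩
    exact ⟨j, h2, by simp [h1]⟩

theorem Formula.mem_freeVarList (A : Formula) (j : ℕ) : j ∈ A.freeVarList ↔ j ∈ A.freeVars := by
  induction A with
  | rel r s t =>
    simp [Formula.freeVarList, Formula.freeVars, ← Term.toFinset_varList]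
  | and A B hA hB => simp [Formula.freeVarList, Formula.freeVars, hA, hB]
  | or A B hA hB => simp [Formula.freeVarList, Formula.freeVars, hA, hB]
  | not A hA => exact hA
  | iff A B hA hB => simp [Formula.freeVarList, Formula.freeVars, hA, hB]
  | all i A hA => rw [Formula.freeVarList, mem_flatMap_ite, hA, Formula.freeVars, Finset.mem_erase]
  | ex i A hA => rw [Formula.freeVarList, mem_flatMap_ite, hA, Formula.freeVars, Finset.mem_erase]

theorem Term.eval_congr {t : Term} {v w : ℕ → ℝ} (h : ∀ j ∈ t.vars, v j = w j) :
    t.eval v = t.eval w := by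
  induction t with
  | var j => exact h j (by simp [Term.vars])
  | zero => rfl
  | one => rfl
  | add s t hs ht | sub s t hs ht | mul s t hs ht =>
    simp only [Term.vars, Finset.mem_union] at h
    simp only [Term.eval, hs fun j hj => h j (.inl hj), ht fun j hj => h j (.inr hj)]

theorem Formula.holds_congr {A : Formula} {v w : ℕ → ℝ} (h : ∀ j ∈ A.freeVars, v j = w j) :
    A.Holds v ↔ A.Holds w := by
  induction A generalizing v w with
  | rel r s t =>
    simp only [Formula.freeVars, Finset.mem_union] at h
    simp only [Formula.Holds, Term.eval_congr fun j hj => h j (.inl hj),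
      Term.eval_congr fun j hj => h j (.inr hj)]
  | and A B hA hB | or A B hA hB | iff A B hA hB =>
    simp only [Formula.freeVars, Finset.mem_union] at h
    simp only [Formula.Holds, hA fun j hj => h j (.inl hj), hB fun j hj => h j (.inr hj)]
  | not A hA => simp only [Formula.Holds, hA h]
  | all i A hA | ex i A hA =>
    have : ∀ x : ℝ, A.Holds (Function.update v i x) ↔ A.Holds (Function.update w i x) := by
      intro x
      refine hA fun j hj => ?_
      rcases eq_or_ne j i with rfl | hne
      · simp
      · simp only [Function.update_of_ne hne]
        exact h j (Finset.mem_erase.2 ⟨hne, hj⟩)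
    simp only [Formula.Holds, this]

/-! ### From normal forms back to formulas. -/

/-- The formula expressing a literal. -/
def litFormula (l : Bool × Term) : Formula :=
  if l.1 = true then .rel .eq l.2 .zero else .rel .lt .zero l.2

/-- The formula expressing a conjunction of literals. -/
def conjFormula (c : List (Bool × Term)) : Formula :=
  c.foldr (fun l A => .and (litFormula l) A) (.rel .eq .zero .zero)

/-- The formula expressing a disjunctive normal form. -/
def dnfFormula (D : List (List (Bool × Term))) : Formula :=
  D.foldr (fun c A => .or (conjFormula c) A) (.rel .lt .zero .zero)

theorem holds_litFormula {v : ℕ → ℝ} {l : Bool × Term} :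
    (litFormula l).Holds v ↔ LitHolds v l := by
  obtain ⟨b, t⟩ := l
  cases b <;> simp [litFormula, LitHolds, Formula.Holds, Rel.Holds, Term.eval]

theorem holds_conjFormula {v : ℕ → ℝ} {c : List (Bool × Term)} :
    (conjFormula c).Holds v ↔ ConjHolds v c := by
  induction c with
  | nil => simp [conjFormula, Formula.Holds, Rel.Holds]
  | cons l c ih => rw [conjHolds_cons, ← ih, ← holds_litFormula]; rfl

theorem holds_dnfFormula {v : ℕ → ℝ} {D : List (List (Bool × Term))} :
    (dnfFormula D).Holds v ↔ DNFHolds v D := by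
  induction D with
  | nil => simp [dnfFormula, DNFHolds, Formula.Holds, Rel.Holds]
  | cons c D ih =>
    rw [dnfHolds_cons, ← ih, ← holds_conjFormula]
    rfl

theorem quantifierFree_dnfFormula (D : List (List (Bool × Term))) :
    (dnfFormula D).QuantifierFree := by
  have hconj : ∀ c : List (Bool × Term), (conjFormula c).QuantifierFree := by
    intro c
    induction c with
    | nil => trivial
    | cons l c ih =>
      refine ⟨?_, ih⟩
      unfold litFormula
      split_ifs <;> trivial
  induction D with
  | nil => trivial
  | cons c D ih => exact ⟨hconj c, ih⟩

theorem freeVars_dnfFormula {D : List (List (Bool × Term))} {V : Finset ℕ}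
    (h : ∀ c ∈ D, ∀ l ∈ c, l.2.vars ⊆ V) : (dnfFormula D).freeVars ⊆ V := by
  have hconj : ∀ c : List (Bool × Term), (∀ l ∈ c, l.2.vars ⊆ V) →
      (conjFormula c).freeVars ⊆ V := by
    intro c
    induction c with
    | nil => simp [conjFormula, Formula.freeVars, Term.vars]
    | cons l c ih =>
      intro hc
      rw [List.forall_mem_cons] at hc
      refine Finset.union_subset ?_ (ih hc.2)
      unfold litFormula
      split_ifs <;> simpa [Formula.freeVars, Term.vars] using hc.1
  induction D with
  | nil => simp [dnfFormula, Formula.freeVars, Term.vars]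
  | cons c D ih =>
    rw [List.forall_mem_cons] at h
    exact Finset.union_subset (hconj c h.1) (ih h.2)

/-- Quantifier elimination. -/
def Formula.elim (A : Formula) : Formula :=
  dnfFormula (A.dnf.map fun c => c.map fun l => (l.1, l.2.restrict A.freeVarList))

theorem Formula.quantifierFree_elim (A : Formula) : A.elim.QuantifierFree :=
  quantifierFree_dnfFormula _

/-- `restrict` enforces the inclusion outright, so variables need not be traced through the
elimination. -/
theorem Formula.freeVars_elim (A : Formula) : A.elim.freeVars ⊆ A.freeVars := by
  refine freeVars_dnfFormula fun c hc l hl => ?_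
  obtain ⟨c', -, rfl⟩ := List.mem_map.1 hc
  obtain ⟨l', -, rfl⟩ := List.mem_map.1 hl
  refine (Term.vars_restrict _ _).trans fun j hj => ?_
  rwa [List.mem_toFinset, A.mem_freeVarList] at hj

/-- Restricting the terms amounts to evaluating the normal form at `v` with the non-free variables
set to `0`, a change that `A` does not see. -/
theorem Formula.holds_elim (A : Formula) (v : ℕ → ℝ) : A.elim.Holds v ↔ A.Holds v := by
  have hD : ∀ D : List (List (Bool × Term)),
      DNFHolds v (D.map fun c => c.map fun l => (l.1, l.2.restrict A.freeVarList)) ↔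
        DNFHolds (fun j => if j ∈ A.freeVarList then v j else 0) D := by
    intro D
    simp [DNFHolds, ConjHolds, LitHolds, Term.eval_restrict]
  rw [Formula.elim, holds_dnfFormula, hD, dnfHolds_dnf]
  refine Formula.holds_congr fun j hj => ?_
  rw [if_pos ((A.mem_freeVarList j).2 hj)]

end RealFO

-- Primitive recursion: closure rules for `fun_prop` and recursion on codes.

attribute [fun_prop] Primrec
attribute [fun_prop] Primrec.id Primrec.const Primrec.fst Primrec.snd

namespace Primrec

section FunProp

variable {α β γ σ : Type*} [Primcodable α] [Primcodable β] [Primcodable γ] [Primcodable σ]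

@[fun_prop] theorem comp_fun {f : β → σ} {g : α → β} (hf : Primrec f) (hg : Primrec g) :
    Primrec fun a => f (g a) := hf.comp hg

@[fun_prop] theorem pair_fun {f : α → β} {g : α → σ} (hf : Primrec f) (hg : Primrec g) :
    Primrec fun a => (f a, g a) := hf.pair hg

@[fun_prop] theorem fst_fun {f : α → β × σ} (hf : Primrec f) : Primrec fun a => (f a).1 :=
  fst.comp hf

@[fun_prop] theorem snd_fun {f : α → β × σ} (hf : Primrec f) : Primrec fun a => (f a).2 :=
  snd.comp hf

@[fun_prop] theorem nat_add_fun {f g : α → ℕ} (hf : Primrec f) (hg : Primrec g) :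
    Primrec fun a => f a + g a := nat_add.comp hf hg

@[fun_prop] theorem nat_sub_fun {f g : α → ℕ} (hf : Primrec f) (hg : Primrec g) :
    Primrec fun a => f a - g a := nat_sub.comp hf hg

@[fun_prop] theorem nat_mod_fun {f g : α → ℕ} (hf : Primrec f) (hg : Primrec g) :
    Primrec fun a => f a % g a := nat_mod.comp hf hg

@[fun_prop] theorem nat_max_fun {f g : α → ℕ} (hf : Primrec f) (hg : Primrec g) :
    Primrec fun a => max (f a) (g a) := nat_max.comp hf hg

@[fun_prop] theorem nat_pair_fun {f g : α → ℕ} (hf : Primrec f) (hg : Primrec g) :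
    Primrec fun a => Nat.pair (f a) (g a) := Primrec₂.natPair.comp hf hg

@[fun_prop] theorem nat_unpair_fun {f : α → ℕ} (hf : Primrec f) :
    Primrec fun a => Nat.unpair (f a) := unpair.comp hf

@[fun_prop] theorem not_fun {f : α → Bool} (hf : Primrec f) : Primrec fun a => !(f a) :=
  Primrec.not.comp hf

@[fun_prop] theorem list_cons_fun {f : α → β} {g : α → List β} (hf : Primrec f)
    (hg : Primrec g) : Primrec fun a => f a :: g a := list_cons.comp hf hg

@[fun_prop] theorem list_append_fun {f g : α → List β} (hf : Primrec f) (hg : Primrec g) :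
    Primrec fun a => f a ++ g a := list_append.comp hf hg

@[fun_prop] theorem list_length_fun {f : α → List β} (hf : Primrec f) :
    Primrec fun a => (f a).length := list_length.comp hf

@[fun_prop] theorem list_getD_fun {f : α → List β} {g : α → ℕ} (hf : Primrec f)
    (hg : Primrec g) (d : β) : Primrec fun a => (f a).getD (g a) d := (list_getD d).comp hf hg

@[fun_prop] theorem list_map_fun {f : α → List β} {g : α → β → σ} (hf : Primrec f)
    (hg : Primrec fun p : α × β => g p.1 p.2) : Primrec fun a => (f a).map (g a) :=
  list_map hf hg

@[fun_prop] theorem list_flatMap_fun {f : α → List β} {g : α → β → List σ} (hf : Primrec f)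
    (hg : Primrec fun p : α × β => g p.1 p.2) : Primrec fun a => (f a).flatMap (g a) :=
  list_flatMap hf hg

@[fun_prop] theorem list_foldr_fun {f : α → List β} {g : α → σ} {h : α → β → σ → σ}
    (hf : Primrec f) (hg : Primrec g) (hh : Primrec fun p : α × β × σ => h p.1 p.2.1 p.2.2) :
    Primrec fun a => (f a).foldr (h a) (g a) :=
  list_foldr (h := fun a p => h a p.1 p.2) hf hg hh

@[fun_prop] theorem tabulate_fun {f : α → ℕ} {g : α → ℕ → σ} (hf : Primrec f)
    (hg : Primrec fun p : α × ℕ => g p.1 p.2) :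
    Primrec fun a => RealFO.tabulate (f a) (g a) :=
  list_map (list_range.comp hf) hg

@[fun_prop] theorem ite_eq_fun [DecidableEq σ] {f g : α → σ} {h k : α → β} (hf : Primrec f)
    (hg : Primrec g) (hh : Primrec h) (hk : Primrec k) :
    Primrec fun a => if f a = g a then h a else k a := ite (Primrec.eq.comp hf hg) hh hk

@[fun_prop] theorem ite_lt_fun {f g : α → ℕ} {h k : α → β} (hf : Primrec f)
    (hg : Primrec g) (hh : Primrec h) (hk : Primrec k) :
    Primrec fun a => if f a < g a then h a else k a := ite (nat_lt.comp hf hg) hh hk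

@[fun_prop] theorem ite_le_fun {f g : α → ℕ} {h k : α → β} (hf : Primrec f)
    (hg : Primrec g) (hh : Primrec h) (hk : Primrec k) :
    Primrec fun a => if f a ≤ g a then h a else k a := ite (nat_le.comp hf hg) hh hk

end FunProp

variable {α σ : Type*} [Primcodable α] [Primcodable σ]

/-- Course-of-values recursion along the components of `Nat.unpair`. -/
theorem of_unpair_rec [Inhabited σ] {G : α → ℕ → σ} {leaf : α → ℕ → σ}
    {node : α → ℕ → σ → σ → σ → σ} (hleaf : Primrec fun p : α × ℕ => leaf p.1 p.2)
    (hnode : Primrec fun p : α × ℕ × σ × σ × σ => node p.1 p.2.1 p.2.2.1 p.2.2.2.1 p.2.2.2.2)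
    (H : ∀ a n, G a n = if n.unpair.1 = 0 then leaf a n.unpair.2 else
      node a n (G a n.unpair.2) (G a n.unpair.2.unpair.1) (G a n.unpair.2.unpair.2)) :
    Primrec₂ G := by
  -- The list holds the values at `0, …, n - 1`, so its length is `n`.
  refine nat_strong_rec G (g := fun a L => some (if L.length.unpair.1 = 0 then
    leaf a L.length.unpair.2 else
      node a L.length (L.getD L.length.unpair.2 default)
        (L.getD L.length.unpair.2.unpair.1 default)
        (L.getD L.length.unpair.2.unpair.2 default))) ?_ ?_
  · have h1 : Primrec fun p : α × List σ => leaf p.1 p.2.length.unpair.2 :=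
      hleaf.comp (g := fun p : α × List σ => (p.1, p.2.length.unpair.2)) (by fun_prop)
    have h2 : Primrec fun p : α × List σ => node p.1 p.2.length
        (p.2.getD p.2.length.unpair.2 default) (p.2.getD p.2.length.unpair.2.unpair.1 default)
        (p.2.getD p.2.length.unpair.2.unpair.2 default) :=
      hnode.comp (g := fun p : α × List σ => (p.1, p.2.length,
        p.2.getD p.2.length.unpair.2 default, p.2.getD p.2.length.unpair.2.unpair.1 default,
        p.2.getD p.2.length.unpair.2.unpair.2 default)) (by fun_prop)
    refine option_some.comp (ite_eq_fun ?_ ?_ h1 h2) <;> fun_prop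
  · intro a n
    simp only [List.length_map, List.length_range]
    rw [H a n]
    split_ifs with h
    · rfl
    -- A nonzero tag makes the second component, and hence its own components, smaller than `n`; the
    -- default values are never read here.
    · have hlt : n.unpair.2 < n := by
        have := Nat.unpair_add_le n
        omega
      have hget : ∀ m < n, ((List.range n).map (G a)).getD m default = G a m := by
        intro m hm
        simp [List.getD, hm]
      rw [hget _ hlt, hget _ ((Nat.unpair_left_le _).trans_lt hlt),
        hget _ ((Nat.unpair_right_le _).trans_lt hlt)]

end Primrec

/-! ### Gödel numbering of terms. -/

namespace RealFO

/-- The term with the given Gödel number. -/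
def Term.ofNat (n : ℕ) : Term :=
  if h : n.unpair.1 = 0 then .var n.unpair.2
  else if n.unpair.1 = 1 then .zero
  else if n.unpair.1 = 2 then .one
  else
    have h1 : n.unpair.2.unpair.1 < n := by
      have := Nat.unpair_add_le n
      have := Nat.unpair_left_le n.unpair.2
      omega
    have h2 : n.unpair.2.unpair.2 < n := by
      have := Nat.unpair_add_le n
      have := Nat.unpair_right_le n.unpair.2
      omega
    if n.unpair.1 = 3 then .add (ofNat n.unpair.2.unpair.1) (ofNat n.unpair.2.unpair.2)
    else if n.unpair.1 = 4 then .sub (ofNat n.unpair.2.unpair.1) (ofNat n.unpair.2.unpair.2)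
    else .mul (ofNat n.unpair.2.unpair.1) (ofNat n.unpair.2.unpair.2)

@[simp] theorem Term.ofNat_code (t : Term) : Term.ofNat t.code = t := by
  induction t <;> rw [Term.code, Term.ofNat] <;> simp_all [Nat.unpair_pair]

variable {α σ : Type*} [Primcodable α] [Primcodable σ]

theorem Term.primrec_ofNat_of_rec [Inhabited σ] {F : α → Term → σ} {fv : α → ℕ → σ}
    {f0 f1 : α → σ} {fa fs fm : α → σ → σ → σ}
    (hv : Primrec fun p : α × ℕ => fv p.1 p.2) (h0 : Primrec f0) (h1 : Primrec f1)
    (ha : Primrec fun p : α × σ × σ => fa p.1 p.2.1 p.2.2)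
    (hs : Primrec fun p : α × σ × σ => fs p.1 p.2.1 p.2.2)
    (hm : Primrec fun p : α × σ × σ => fm p.1 p.2.1 p.2.2)
    (ev : ∀ a i, F a (.var i) = fv a i) (e0 : ∀ a, F a .zero = f0 a) (e1 : ∀ a, F a .one = f1 a)
    (ea : ∀ a s t, F a (.add s t) = fa a (F a s) (F a t))
    (es : ∀ a s t, F a (.sub s t) = fs a (F a s) (F a t))
    (em : ∀ a s t, F a (.mul s t) = fm a (F a s) (F a t)) :
    Primrec₂ fun a n => F a (.ofNat n) := by
  refine Primrec.of_unpair_rec (leaf := fv) (node := fun a n _ y z =>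
    if n.unpair.1 = 1 then f0 a else if n.unpair.1 = 2 then f1 a
    else if n.unpair.1 = 3 then fa a y z else if n.unpair.1 = 4 then fs a y z else fm a y z)
    hv ?_ ?_
  · have ha' : Primrec fun p : α × ℕ × σ × σ × σ => fa p.1 p.2.2.2.1 p.2.2.2.2 :=
      ha.comp (g := fun p : α × ℕ × σ × σ × σ => (p.1, p.2.2.2.1, p.2.2.2.2)) (by fun_prop)
    have hs' : Primrec fun p : α × ℕ × σ × σ × σ => fs p.1 p.2.2.2.1 p.2.2.2.2 :=
      hs.comp (g := fun p : α × ℕ × σ × σ × σ => (p.1, p.2.2.2.1, p.2.2.2.2)) (by fun_prop)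
    have hm' : Primrec fun p : α × ℕ × σ × σ × σ => fm p.1 p.2.2.2.1 p.2.2.2.2 :=
      hm.comp (g := fun p : α × ℕ × σ × σ × σ => (p.1, p.2.2.2.1, p.2.2.2.2)) (by fun_prop)
    fun_prop
  · intro a n
    rw [Term.ofNat]
    split_ifs <;> simp only [ev, e0, e1, ea, es, em]

instance : Inhabited Term := ⟨.zero⟩

/-- `Term.ofNat` is total but not injective, so this is a normalisation of codes and not the
identity. Its primitive recursiveness is what the `Primcodable` instance demands. -/
theorem Term.primrec_code_ofNat : Primrec fun n => (Term.ofNat n).code := by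
  have : Primrec₂ fun (_ : Unit) n => (Term.ofNat n).code :=
    Term.primrec_ofNat_of_rec (F := fun _ t => t.code) (fv := fun _ i => Nat.pair 0 i)
      (f0 := fun _ => Nat.pair 1 0) (f1 := fun _ => Nat.pair 2 0)
      (fa := fun _ x y => Nat.pair 3 (Nat.pair x y))
      (fs := fun _ x y => Nat.pair 4 (Nat.pair x y))
      (fm := fun _ x y => Nat.pair 5 (Nat.pair x y))
      (by fun_prop) (by fun_prop) (by fun_prop) (by fun_prop) (by fun_prop) (by fun_prop)
      (fun _ _ => rfl) (fun _ => rfl) (fun _ => rfl) (fun _ _ _ => rfl) (fun _ _ _ => rfl)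
      (fun _ _ _ => rfl)
  exact this.comp (Primrec.const ()) Primrec.id

/-- Terms are encoded by their Gödel numbers. -/
instance : Primcodable Term where
  encode := Term.code
  decode n := some (Term.ofNat n)
  encodek t := by rw [Term.ofNat_code]
  prim := Primrec.nat_iff.1 (Primrec.succ.comp Term.primrec_code_ofNat)

theorem Term.primrec_code : Primrec Term.code := Primrec.encode

@[fun_prop] theorem Term.primrec_ofNat : Primrec Term.ofNat :=
  Primrec.option_some_iff.1 (Primrec.decode (α := Term))

@[fun_prop] theorem Term.primrec_var {f : α → ℕ} (hf : Primrec f) :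
    Primrec fun a => Term.var (f a) :=
  Primrec.encode_iff.1 (show Primrec fun a => Nat.pair 0 (f a) by fun_prop)

@[fun_prop] theorem Term.primrec_add {f g : α → Term} (hf : Primrec f) (hg : Primrec g) :
    Primrec fun a => Term.add (f a) (g a) := by
  have h1 := Term.primrec_code.comp hf
  have h2 := Term.primrec_code.comp hg
  exact Primrec.encode_iff.1
    (show Primrec fun a => Nat.pair 3 (Nat.pair (f a).code (g a).code) by fun_prop)

@[fun_prop] theorem Term.primrec_sub {f g : α → Term} (hf : Primrec f) (hg : Primrec g) :
    Primrec fun a => Term.sub (f a) (g a) := by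
  have h1 := Term.primrec_code.comp hf
  have h2 := Term.primrec_code.comp hg
  exact Primrec.encode_iff.1
    (show Primrec fun a => Nat.pair 4 (Nat.pair (f a).code (g a).code) by fun_prop)

@[fun_prop] theorem Term.primrec_mul {f g : α → Term} (hf : Primrec f) (hg : Primrec g) :
    Primrec fun a => Term.mul (f a) (g a) := by
  have h1 := Term.primrec_code.comp hf
  have h2 := Term.primrec_code.comp hg
  exact Primrec.encode_iff.1
    (show Primrec fun a => Nat.pair 5 (Nat.pair (f a).code (g a).code) by fun_prop)

theorem Term.primrec_of_rec [Inhabited σ] {F : α → Term → σ} {fv : α → ℕ → σ}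
    {f0 f1 : α → σ} {fa fs fm : α → σ → σ → σ}
    (hv : Primrec fun p : α × ℕ => fv p.1 p.2) (h0 : Primrec f0) (h1 : Primrec f1)
    (ha : Primrec fun p : α × σ × σ => fa p.1 p.2.1 p.2.2)
    (hs : Primrec fun p : α × σ × σ => fs p.1 p.2.1 p.2.2)
    (hm : Primrec fun p : α × σ × σ => fm p.1 p.2.1 p.2.2)
    (ev : ∀ a i, F a (.var i) = fv a i) (e0 : ∀ a, F a .zero = f0 a) (e1 : ∀ a, F a .one = f1 a)
    (ea : ∀ a s t, F a (.add s t) = fa a (F a s) (F a t))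
    (es : ∀ a s t, F a (.sub s t) = fs a (F a s) (F a t))
    (em : ∀ a s t, F a (.mul s t) = fm a (F a s) (F a t)) :
    Primrec₂ F :=
  ((Term.primrec_ofNat_of_rec hv h0 h1 ha hs hm ev e0 e1 ea es em).comp Primrec.fst
    (Term.primrec_code.comp Primrec.snd)).of_eq fun p => by simp

/-! ### Primitive recursiveness of the elimination procedure. -/

@[fun_prop] theorem primrec_cross {f g : α → List (List (Bool × Term))} (hf : Primrec f)
    (hg : Primrec g) : Primrec fun a => cross (f a) (g a) := by
  unfold cross; fun_prop

@[fun_prop] theorem primrec_negLit : Primrec negLit := by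
  unfold negLit; fun_prop

@[fun_prop] theorem primrec_negDNF : Primrec negDNF := by
  unfold negDNF; fun_prop

@[fun_prop] theorem primrec_sumTerm : Primrec sumTerm := by
  unfold sumTerm; fun_prop

@[fun_prop] theorem primrec_prodTerm : Primrec prodTerm := by
  unfold prodTerm; fun_prop

@[fun_prop] theorem primrec_addPoly {f g : α → List Term} (hf : Primrec f) (hg : Primrec g) :
    Primrec fun a => addPoly (f a) (g a) := by
  unfold addPoly; fun_prop

@[fun_prop] theorem primrec_subPoly {f g : α → List Term} (hf : Primrec f) (hg : Primrec g) :
    Primrec fun a => subPoly (f a) (g a) := by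
  unfold subPoly; fun_prop

@[fun_prop] theorem primrec_mulPoly {f g : α → List Term} (hf : Primrec f) (hg : Primrec g) :
    Primrec fun a => mulPoly (f a) (g a) := by
  unfold mulPoly; fun_prop

@[fun_prop] theorem primrec_toPoly {f : α → ℕ} {g : α → Term} (hf : Primrec f)
    (hg : Primrec g) : Primrec fun a => toPoly (f a) (g a) := by
  have : Primrec₂ toPoly := Term.primrec_of_rec
    (fv := fun i j => if j = i then [Term.zero, .one] else [.var j])
    (f0 := fun _ => []) (f1 := fun _ => [.one]) (fa := fun _ p q => addPoly p q)
    (fs := fun _ p q => subPoly p q) (fm := fun _ p q => mulPoly p q)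
    (by fun_prop) (by fun_prop) (by fun_prop) (by fun_prop) (by fun_prop) (by fun_prop)
    (fun _ _ => rfl) (fun _ => rfl) (fun _ => rfl) (fun _ _ _ => rfl) (fun _ _ _ => rfl)
    (fun _ _ _ => rfl)
  exact this.comp hf hg

@[fun_prop] theorem primrec_deriv {f : α → ℕ} {g : α → Term} (hf : Primrec f)
    (hg : Primrec g) : Primrec fun a => deriv (f a) (g a) := by
  -- The product rule needs the factors besides their derivatives, so the recursion carries both.
  have : Primrec₂ fun i t => (t, deriv i t) := Term.primrec_of_rec
    (fv := fun i j => (Term.var j, if j = i then .one else .zero))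
    (f0 := fun _ => (.zero, .zero)) (f1 := fun _ => (.one, .zero))
    (fa := fun _ p q => (.add p.1 q.1, .add p.2 q.2))
    (fs := fun _ p q => (.sub p.1 q.1, .sub p.2 q.2))
    (fm := fun _ p q => (.mul p.1 q.1, .add (.mul p.2 q.1) (.mul p.1 q.2)))
    (by fun_prop) (by fun_prop) (by fun_prop) (by fun_prop) (by fun_prop) (by fun_prop)
    (fun _ _ => rfl) (fun _ => rfl) (fun _ => rfl) (fun _ _ _ => rfl) (fun _ _ _ => rfl)
    (fun _ _ _ => rfl)
  exact Primrec.snd.comp (this.comp hf hg)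

@[fun_prop] theorem primrec_lead {f : α → List Term} (hf : Primrec f) :
    Primrec fun a => lead (f a) := by
  unfold lead; fun_prop

@[fun_prop] theorem primrec_dropLead {f : α → List Term} (hf : Primrec f) :
    Primrec fun a => dropLead (f a) := by
  unfold dropLead; fun_prop

@[fun_prop] theorem primrec_reduce {c d : α → Term} {f g : α → List Term} (hc : Primrec c)
    (hd : Primrec d) (hf : Primrec f) (hg : Primrec g) :
    Primrec fun a => reduce (c a) (d a) (f a) (g a) := by
  unfold reduce; fun_prop

@[fun_prop] theorem primrec_euclid {f g : α → List Term} (hf : Primrec f) (hg : Primrec g) :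
    Primrec fun a => euclid (f a) (g a) := by
  unfold euclid; fun_prop

@[fun_prop] theorem primrec_flips {f g : α → List Term} (hf : Primrec f) (hg : Primrec g) :
    Primrec fun a => flips (f a) (g a) := by
  unfold flips; fun_prop

@[fun_prop] theorem primrec_step : Primrec step := by
  have h : Primrec fun p : (List (Bool × Term) × List (List Term × List Term) × ℕ × ℕ) ×
      (List Term × List Term) × List (List Term × List Term) =>
      if p.2.1.1.length = 0 ∨ p.2.1.2.length = 0 then [(p.1.1, p.2.2, p.1.2.2)]
      else
      [((true, lead p.2.1.1) :: p.1.1, (dropLead p.2.1.1, p.2.1.2) :: p.2.2, p.1.2.2),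
        ((true, lead p.2.1.2) :: p.1.1, (p.2.1.1, dropLead p.2.1.2) :: p.2.2, p.1.2.2),
        ((false, .mul (lead p.2.1.1) (lead p.2.1.2)) :: p.1.1,
          euclid p.2.1.1 p.2.1.2 :: p.2.2,
          p.1.2.2.1 + flips p.2.1.1 p.2.1.2, p.1.2.2.2),
        ((false, .sub .zero (.mul (lead p.2.1.1) (lead p.2.1.2))) :: p.1.1,
          euclid p.2.1.1 p.2.1.2 :: p.2.2,
          p.1.2.2.1, p.1.2.2.2 + flips p.2.1.1 p.2.1.2)] := by
    refine Primrec.ite (PrimrecPred.or (Primrec.eq.comp ?_ ?_) (Primrec.eq.comp ?_ ?_)) ?_ ?_ <;>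
      fun_prop
  refine (Primrec.list_casesOn (f := fun s : List (Bool × Term) ×
    List (List Term × List Term) × ℕ × ℕ => s.2.1) (g := fun s => [s]) (by fun_prop)
    (by fun_prop) h.to₂).of_eq fun s => ?_
  obtain ⟨g, L, m⟩ := s
  cases L <;> rfl

@[fun_prop] theorem primrec_fuel : Primrec fuel := by
  unfold fuel; fun_prop

@[fun_prop] theorem primrec_run : Primrec run :=
  Primrec.nat_iterate primrec_fuel (h := fun _ S => S.flatMap step)
    (g := fun L => [([], L, 0, 0)]) (by fun_prop)
    (show Primrec fun p : List (List Term × List Term) ×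
      List (List (Bool × Term) × List (List Term × List Term) × ℕ × ℕ) => p.2.flatMap step
      by fun_prop)

@[fun_prop] theorem primrec_indexSumPos : Primrec indexSumPos := by
  unfold indexSumPos; fun_prop

@[fun_prop] theorem primrec_products : Primrec products := by
  unfold products; fun_prop

@[fun_prop] theorem primrec_rootDNF {f : α → ℕ} {g : α → Term} {h : α → List Term}
    (hf : Primrec f) (hg : Primrec g) (hh : Primrec h) :
    Primrec fun a => rootDNF (f a) (g a) (h a) := by
  unfold rootDNF; fun_prop

@[fun_prop] theorem primrec_criticalTerm {f : α → ℕ} {g : α → Term} (hf : Primrec f)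
    (hg : Primrec g) : Primrec fun a => criticalTerm (f a) (g a) := by
  unfold criticalTerm; fun_prop

@[fun_prop] theorem primrec_filter_fst (b : Bool) :
    Primrec fun c : List (Bool × Term) => c.filter fun l => l.1 = b :=
  Primrec.listFilter (Primrec.eq.comp Primrec.fst (Primrec.const b))

@[fun_prop] theorem primrec_elimConj {f : α → ℕ} {g : α → List (Bool × Term)} (hf : Primrec f)
    (hg : Primrec g) : Primrec fun a => elimConj (f a) (g a) := by
  unfold elimConj
  have h1 := (primrec_filter_fst true).comp hg
  have h2 := (primrec_filter_fst false).comp hg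
  fun_prop

@[fun_prop] theorem primrec_relDNF (r : Rel) {f g : α → Term} (hf : Primrec f) (hg : Primrec g) :
    Primrec fun a => relDNF r (f a) (g a) := by
  cases r <;> simp only [relDNF] <;> fun_prop

theorem Term.primrec_restrict {f : α → List ℕ} {g : α → Term} (hf : Primrec f)
    (hg : Primrec g) : Primrec fun a => (g a).restrict (f a) := by
  -- Membership in a list is tested by comparing `idxOf` with the length.
  have hv : Primrec fun p : List ℕ × ℕ => if p.2 ∈ p.1 then Term.var p.2 else .zero := by
    refine (Primrec.ite (Primrec.nat_lt.comp (Primrec.list_idxOf.comp Primrec.snd Primrec.fst)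
      (Primrec.list_length.comp Primrec.fst)) (f := fun p : List ℕ × ℕ => Term.var p.2)
      (g := fun _ => Term.zero) (by fun_prop) (by fun_prop)).of_eq fun p => ?_
    simp only [List.idxOf_lt_length_iff]
  have : Primrec₂ fun L t => Term.restrict L t := Term.primrec_of_rec
    (fv := fun L j => if j ∈ L then .var j else .zero)
    (f0 := fun _ => .zero) (f1 := fun _ => .one) (fa := fun _ s t => .add s t)
    (fs := fun _ s t => .sub s t) (fm := fun _ s t => .mul s t)
    hv (by fun_prop) (by fun_prop) (by fun_prop) (by fun_prop) (by fun_prop)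
    (fun _ _ => rfl) (fun _ => rfl) (fun _ => rfl) (fun _ _ _ => rfl) (fun _ _ _ => rfl)
    (fun _ _ _ => rfl)
  exact this.comp hf hg

@[fun_prop] theorem Term.primrec_varList : Primrec Term.varList := by
  have : Primrec₂ fun (_ : Unit) t => Term.varList t := Term.primrec_of_rec
    (fv := fun _ j => [j]) (f0 := fun _ => []) (f1 := fun _ => []) (fa := fun _ s t => s ++ t)
    (fs := fun _ s t => s ++ t) (fm := fun _ s t => s ++ t)
    (by fun_prop) (by fun_prop) (by fun_prop) (by fun_prop) (by fun_prop) (by fun_prop)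
    (fun _ _ => rfl) (fun _ => rfl) (fun _ => rfl) (fun _ _ _ => rfl) (fun _ _ _ => rfl)
    (fun _ _ _ => rfl)
  exact this.comp (Primrec.const ()) Primrec.id

/-! ### Gödel numbering of formulas. -/

/-- The relation symbol with the given number. -/
def Rel.ofNat (n : ℕ) : Rel :=
  if n = 0 then .le else if n = 1 then .lt else if n = 2 then .ge else if n = 3 then .gt
  else if n = 4 then .eq else .ne

/-- The formula with the given Gödel number. -/
def Formula.ofNat (n : ℕ) : Formula :=
  if h : n.unpair.1 = 0 then
    .rel (.ofNat n.unpair.2.unpair.1) (.ofNat n.unpair.2.unpair.2.unpair.1)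
      (.ofNat n.unpair.2.unpair.2.unpair.2)
  else
    have h0 : n.unpair.2 < n := by
      have := Nat.unpair_add_le n
      omega
    have h1 : n.unpair.2.unpair.1 < n := (Nat.unpair_left_le _).trans_lt h0
    have h2 : n.unpair.2.unpair.2 < n := (Nat.unpair_right_le _).trans_lt h0
    if n.unpair.1 = 1 then .and (ofNat n.unpair.2.unpair.1) (ofNat n.unpair.2.unpair.2)
    else if n.unpair.1 = 2 then .or (ofNat n.unpair.2.unpair.1) (ofNat n.unpair.2.unpair.2)
    else if n.unpair.1 = 3 then .not (ofNat n.unpair.2)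
    else if n.unpair.1 = 4 then .iff (ofNat n.unpair.2.unpair.1) (ofNat n.unpair.2.unpair.2)
    else if n.unpair.1 = 5 then .all n.unpair.2.unpair.1 (ofNat n.unpair.2.unpair.2)
    else .ex n.unpair.2.unpair.1 (ofNat n.unpair.2.unpair.2)

@[simp] theorem Formula.ofNat_code (A : Formula) : Formula.ofNat A.code = A := by
  induction A with
  | rel r s t =>
    rw [Formula.code, Formula.ofNat]
    cases r <;> simp [Rel.code, Rel.ofNat]
  | _ => rw [Formula.code, Formula.ofNat]; simp_all

theorem Formula.primrec_dnf_ofNat : Primrec fun n => (Formula.ofNat n).dnf := by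
  have hleaf : Primrec fun p : Unit × ℕ => relDNF (.ofNat p.2.unpair.1)
      (.sub (.ofNat p.2.unpair.2.unpair.1) (.ofNat p.2.unpair.2.unpair.2))
      (.sub (.ofNat p.2.unpair.2.unpair.2) (.ofNat p.2.unpair.2.unpair.1)) := by
    have hite : ∀ (n : ℕ) (d e : Term), relDNF (.ofNat n) d e =
        if n = 0 then relDNF .le d e else if n = 1 then relDNF .lt d e else
        if n = 2 then relDNF .ge d e else if n = 3 then relDNF .gt d e else
        if n = 4 then relDNF .eq d e else relDNF .ne d e := by
      intro n d e
      unfold Rel.ofNat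
      split_ifs <;> rfl
    simp only [hite]
    fun_prop
  have : Primrec₂ fun (_ : Unit) n => (Formula.ofNat n).dnf := by
    -- Here `x` is the value at the whole second component, as negation needs, while `y` and `z` are
    -- the values at its two halves. For a quantifier the first half is the variable's index, so `y`
    -- is ignored.
    refine Primrec.of_unpair_rec (leaf := fun _ m => relDNF (.ofNat m.unpair.1)
      (.sub (.ofNat m.unpair.2.unpair.1) (.ofNat m.unpair.2.unpair.2))
      (.sub (.ofNat m.unpair.2.unpair.2) (.ofNat m.unpair.2.unpair.1)))
      (node := fun _ n x y z => if n.unpair.1 = 1 then cross y z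
        else if n.unpair.1 = 2 then y ++ z
        else if n.unpair.1 = 3 then negDNF x
        else if n.unpair.1 = 4 then cross y z ++ cross (negDNF y) (negDNF z)
        else if n.unpair.1 = 5 then
          negDNF ((negDNF z).flatMap fun c => elimConj n.unpair.2.unpair.1 c)
        else z.flatMap fun c => elimConj n.unpair.2.unpair.1 c) hleaf ?_ ?_
    · fun_prop
    · intro _ n
      rw [Formula.ofNat]
      split_ifs <;> rfl
  exact this.comp (Primrec.const ()) Primrec.id

theorem Formula.primrec_freeVarList_ofNat : Primrec fun n => (Formula.ofNat n).freeVarList := by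
  have : Primrec₂ fun (_ : Unit) n => (Formula.ofNat n).freeVarList := by
    refine Primrec.of_unpair_rec (leaf := fun _ m => (Term.ofNat m.unpair.2.unpair.1).varList ++
        (Term.ofNat m.unpair.2.unpair.2).varList)
      (node := fun _ n x y z => if n.unpair.1 = 1 then y ++ z
        else if n.unpair.1 = 2 then y ++ z
        else if n.unpair.1 = 3 then x
        else if n.unpair.1 = 4 then y ++ z
        else z.flatMap fun j => if j = n.unpair.2.unpair.1 then [] else [j]) ?_ ?_ ?_
    · fun_prop
    · fun_prop
    · intro _ n
      rw [Formula.ofNat]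
      split_ifs <;> rfl
  exact this.comp (Primrec.const ()) Primrec.id

theorem primrec_code_litFormula : Primrec fun l => (litFormula l).code := by
  have h := Term.primrec_code.comp (Primrec.snd (α := Bool) (β := Term))
  refine (show Primrec fun l : Bool × Term => if l.1 = true then
      Nat.pair 0 (Nat.pair 4 (Nat.pair l.2.code Term.zero.code))
    else Nat.pair 0 (Nat.pair 1 (Nat.pair Term.zero.code l.2.code)) by fun_prop).of_eq fun l => ?_
  unfold litFormula
  split_ifs <;> rfl

theorem primrec_code_conjFormula : Primrec fun c => (conjFormula c).code := by
  have h : Primrec fun p : List (Bool × Term) × (Bool × Term) × ℕ => (litFormula p.2.1).code :=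
    primrec_code_litFormula.comp (Primrec.fst.comp Primrec.snd)
  refine (Primrec.list_foldr_fun (h := fun _ l n => Nat.pair 1 (Nat.pair (litFormula l).code n))
    Primrec.id (Primrec.const (conjFormula []).code)
    (Primrec.nat_pair_fun (Primrec.const 1) (Primrec.nat_pair_fun h (by fun_prop)))).of_eq
    fun c => ?_
  simp only [id]
  induction c with
  | nil => rfl
  | cons l c ih => rw [List.foldr_cons, ih]; rfl

theorem primrec_code_dnfFormula : Primrec fun D => (dnfFormula D).code := by
  have h : Primrec fun p : List (List (Bool × Term)) × List (Bool × Term) × ℕ =>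
      (conjFormula p.2.1).code :=
    primrec_code_conjFormula.comp (Primrec.fst.comp Primrec.snd)
  refine (Primrec.list_foldr_fun (h := fun _ c n => Nat.pair 2 (Nat.pair (conjFormula c).code n))
    Primrec.id (Primrec.const (dnfFormula []).code)
    (Primrec.nat_pair_fun (Primrec.const 2) (Primrec.nat_pair_fun h (by fun_prop)))).of_eq
    fun D => ?_
  simp only [id]
  induction D with
  | nil => rfl
  | cons c D ih => rw [List.foldr_cons, ih]; rfl

theorem Formula.primrec_code_elim_ofNat : Primrec fun n => (Formula.ofNat n).elim.code := by
  have hr : Primrec fun p : (ℕ × List (Bool × Term)) × Bool × Term =>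
      (p.2.1, p.2.2.restrict (Formula.ofNat p.1.1).freeVarList) :=
    (Primrec.fst.comp Primrec.snd).pair (Term.primrec_restrict
      (Formula.primrec_freeVarList_ofNat.comp (Primrec.fst.comp Primrec.fst))
      (Primrec.snd.comp Primrec.snd))
  exact primrec_code_dnfFormula.comp
    (Primrec.list_map Formula.primrec_dnf_ofNat (Primrec.list_map Primrec.snd hr))

end RealFO

theorem theoremt :
    ∃ f : ℕ → ℕ, Computable f ∧
      ∀ Ψ : RealFO.Formula, ∃ Φ : RealFO.Formula,
        f Ψ.code = Φ.code ∧
        Φ.QuantifierFree ∧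
        Φ.freeVars ⊆ Ψ.freeVars ∧
        ∀ y : ℕ → ℝ, Ψ.Holds y ↔ Φ.Holds y := by
  refine ⟨_, RealFO.Formula.primrec_code_elim_ofNat.to_comp, fun Ψ => ⟨Ψ.elim, ?_,
    Ψ.quantifierFree_elim, Ψ.freeVars_elim, fun y => (Ψ.holds_elim y).symm⟩⟩
  simp only [RealFO.Formula.ofNat_code]
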